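/- Let $\lambda>-1$. For $t\in\mathbb{R}$ let $P_n(x)=P_n(x;t)$, $n=0,1,2,\dots$, be the monic polynomials of degree $n$ that are orthogonal with respect to the generalized Airy weight $w(x;t)=x^{\lambda}e^{-\frac13x^3+tx}$ on $(0,\infty)$, i.e. $\int_0^\infty P_m(x)P_n(x)w(x;t)\,dx=0$ for $m\neq n$. Let $\mathbf{p}(n,t)$ be the sub-leading coefficient of $P_n$, that is, the coefficient of $x^{n-1}$ in $P_n(x;t)=x^n+\mathbf{p}(n,t)x^{n-1}+\cdots$, with $\mathbf{p}(0,t)=0$. Then for every fixed $n$, as $t\to+\infty$, $$\mathbf{p}(n,t)=-n\sqrt{t}+\frac{n(n-2\lambda)}{4t}+\frac{n(4n^2-24n\lambda+12\lambda^2+1)}{32\,t^{5/2}}+O(t^{-4}),$$ and, as $t\to-\infty$, $$\mathbf{p}(n,t)=\frac{n(n+\lambda)}{t}+\frac{n(n+\lambda)(5n^2+5n\lambda+\lambda^2+1)}{t^4}+O(t^{-7}).$$ The implied constants may depend on $n$ and $\lambda$. -/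

import Mathlib

open Polynomial Filter Asymptotics MeasureTheory

/-- The generalized Airy weight `w(x; t) = x^lam * exp (-x^3/3 + t x)`, considered on `(0, ∞)`. -/
noncomputable def airyWeight (lam t x : ℝ) : ℝ :=
  x ^ lam * Real.exp (-(1 / 3) * x ^ 3 + t * x)

/-- The pairing `∫₀^∞ p(x) q(x) w(x; t) dx` of real polynomials. -/
noncomputable def airyPairing (lam t : ℝ) (p q : ℝ[X]) : ℝ :=
  ∫ x in Set.Ioi (0 : ℝ), p.eval x * q.eval x * airyWeight lam t x

/-- The monic polynomials orthogonal with respect to the generalized Airy weight, built by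
Gram-Schmidt orthogonalization of the monomials. For `-1 < lam` they are the unique orthogonal
family with one monic polynomial of each degree: see `airyPoly_monic`, `airyPoly_natDegree`,
`airyPairing_airyPoly`, `airyPairing_airyPoly_self_pos`, `airyPoly_unique`. -/
noncomputable def airyPoly (lam t : ℝ) (n : ℕ) : ℝ[X] :=
  X ^ n - ∑ k : Fin n,
    C (airyPairing lam t (X ^ n) (airyPoly lam t k) /
        airyPairing lam t (airyPoly lam t k) (airyPoly lam t k)) * airyPoly lam t k
termination_by n
decreasing_by all_goals exact k.isLt

/-- The sub-leading coefficient `p(n, t)` of the monic orthogonal polynomial `P_n(x; t)`: the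
coefficient of `x^(n-1)` if `n ≥ 1`, and `0` if `n = 0`. -/
noncomputable def airySubleading (lam : ℝ) (n : ℕ) (t : ℝ) : ℝ :=
  if n = 0 then 0 else (airyPoly lam t n).coeff (n - 1)

lemma airyPoly_sub_degree_lt (lam t : ℝ) (n : ℕ) :
    (airyPoly lam t n - X ^ n).degree < (n : WithBot ℕ) := by
  induction n using Nat.strong_induction_on with
  | _ n ih =>
    have h : ∀ k : Fin n, (airyPoly lam t k).degree ≤ ((k : ℕ) : WithBot ℕ) := by
      intro k
      have h1 : airyPoly lam t k = (airyPoly lam t k - X ^ (k : ℕ)) + X ^ (k : ℕ) := by ring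
      rw [h1]
      exact (degree_add_le _ _).trans (max_le (ih k k.isLt).le (degree_X_pow_le _))
    rw [airyPoly, sub_sub_cancel_left, degree_neg]
    refine (degree_sum_le _ _).trans_lt ?_
    refine (Finset.sup_lt_iff (WithBot.bot_lt_coe n)).2 fun k _ => ?_
    rw [← smul_eq_C_mul]
    refine (degree_smul_le _ _).trans_lt ((h k).trans_lt ?_)
    exact WithBot.coe_lt_coe.2 k.isLt

lemma airyPoly_monic (lam t : ℝ) (n : ℕ) : (airyPoly lam t n).Monic := by
  have h : airyPoly lam t n = X ^ n + (airyPoly lam t n - X ^ n) := by ring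
  rw [h]
  exact monic_X_pow_add (airyPoly_sub_degree_lt lam t n)

lemma airyPoly_natDegree (lam t : ℝ) (n : ℕ) : (airyPoly lam t n).natDegree = n := by
  have h : airyPoly lam t n = X ^ n + (airyPoly lam t n - X ^ n) := by ring
  have h1 := airyPoly_sub_degree_lt lam t n
  rw [h, natDegree_eq_of_degree_eq_some]
  rw [degree_add_eq_left_of_degree_lt (by simpa using h1), degree_X_pow]

lemma airyWeight_pos (lam t : ℝ) {x : ℝ} (hx : 0 < x) : 0 < airyWeight lam t x :=
  mul_pos (Real.rpow_pos_of_pos hx _) (Real.exp_pos _)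

lemma measurable_airyWeight (lam t : ℝ) : Measurable (airyWeight lam t) := by
  unfold airyWeight
  fun_prop

lemma integrableOn_pow_mul_airyWeight {lam : ℝ} (hlam : -1 < lam) (t : ℝ) (k : ℕ) :
    IntegrableOn (fun x => x ^ k * airyWeight lam t x) (Set.Ioi 0) := by
  have hG : IntegrableOn (fun x : ℝ => Real.exp (-x) * x ^ ((lam + k + 1) - 1)) (Set.Ioi 0) :=
    Real.GammaIntegral_convergent (by have : (0 : ℝ) ≤ k := k.cast_nonneg; linarith)
  set c : ℝ := |t| + 1 with hc
  have hc1 : 1 ≤ c := by have := abs_nonneg t; linarith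
  refine Integrable.mono' (hG.const_mul (Real.exp (c * (3 * c + 1))))
    ((by fun_prop : Measurable fun x : ℝ => x ^ k).mul
      (measurable_airyWeight lam t)).aestronglyMeasurable ?_
  refine (ae_restrict_iff' measurableSet_Ioi).2 (Eventually.of_forall fun x hx => ?_)
  have hx : 0 < x := hx
  have hb : -(1 / 3) * x ^ 3 + t * x ≤ c * (3 * c + 1) + -x := by
    have ht : t * x ≤ |t| * x := mul_le_mul_of_nonneg_right (le_abs_self t) hx.le
    have hm : c * x - (1 / 3) * x ^ 3 ≤ c * (3 * c + 1) := by
      rcases le_total (x ^ 2) (3 * c) with h | h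
      · have : x ≤ 3 * c + 1 := by nlinarith [sq_nonneg (x - 1)]
        nlinarith [pow_pos hx 3, mul_le_mul_of_nonneg_left this (by linarith : (0 : ℝ) ≤ c)]
      · have : 3 * c * x ≤ x ^ 3 := by nlinarith
        nlinarith
    have : c * x = |t| * x + x := by rw [hc]; ring
    linarith
  have he : x ^ k * x ^ lam = x ^ ((lam + k + 1) - 1) := by
    rw [← Real.rpow_natCast, ← Real.rpow_add hx]
    congr 1
    ring
  rw [Real.norm_of_nonneg (mul_pos (pow_pos hx k) (airyWeight_pos lam t hx)).le, airyWeight,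
    ← mul_assoc, he, ← mul_assoc, ← Real.exp_add, mul_comm]
  exact mul_le_mul_of_nonneg_right (Real.exp_le_exp.2 hb) (Real.rpow_nonneg hx.le _)

lemma integrableOn_eval_mul_airyWeight {lam : ℝ} (hlam : -1 < lam) (t : ℝ) (p : ℝ[X]) :
    IntegrableOn (fun x => p.eval x * airyWeight lam t x) (Set.Ioi 0) := by
  simp only [eval_eq_sum_range, Finset.sum_mul, mul_assoc]
  exact integrable_finsetSum _ fun k _ =>
    (integrableOn_pow_mul_airyWeight hlam t k).const_mul (p.coeff k)

lemma integrableOn_airyPairing {lam : ℝ} (hlam : -1 < lam) (t : ℝ) (p q : ℝ[X]) :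
    IntegrableOn (fun x => p.eval x * q.eval x * airyWeight lam t x) (Set.Ioi 0) := by
  simpa using integrableOn_eval_mul_airyWeight hlam t (p * q)

lemma airyPairing_comm (lam t : ℝ) (p q : ℝ[X]) :
    airyPairing lam t p q = airyPairing lam t q p := by
  simp only [airyPairing, mul_comm (eval _ p)]

lemma airyPairing_sub_left {lam : ℝ} (hlam : -1 < lam) (t : ℝ) (p q r : ℝ[X]) :
    airyPairing lam t (p - q) r = airyPairing lam t p r - airyPairing lam t q r := by
  simp only [airyPairing, eval_sub, sub_mul]
  exact integral_sub (integrableOn_airyPairing hlam t p r) (integrableOn_airyPairing hlam t q r)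

lemma airyPairing_add_left {lam : ℝ} (hlam : -1 < lam) (t : ℝ) (p q r : ℝ[X]) :
    airyPairing lam t (p + q) r = airyPairing lam t p r + airyPairing lam t q r := by
  simp only [airyPairing, eval_add, add_mul]
  exact integral_add (integrableOn_airyPairing hlam t p r) (integrableOn_airyPairing hlam t q r)

lemma airyPairing_C_mul_left (lam t a : ℝ) (p r : ℝ[X]) :
    airyPairing lam t (C a * p) r = a * airyPairing lam t p r := by
  simp only [airyPairing, eval_mul, eval_C, mul_assoc]
  exact integral_const_mul _ _

lemma airyPairing_sum_left {lam : ℝ} (hlam : -1 < lam) (t : ℝ) {ι : Type*} (s : Finset ι)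
    (f : ι → ℝ[X]) (r : ℝ[X]) :
    airyPairing lam t (∑ i ∈ s, f i) r = ∑ i ∈ s, airyPairing lam t (f i) r := by
  simp only [airyPairing, eval_finsetSum, Finset.sum_mul]
  exact integral_finsetSum _ fun i _ => integrableOn_airyPairing hlam t (f i) r

lemma airyPairing_self_pos {lam : ℝ} (hlam : -1 < lam) (t : ℝ) {p : ℝ[X]} (hp : p ≠ 0) :
    0 < airyPairing lam t p p := by
  have hnn : 0 ≤ᵐ[volume.restrict (Set.Ioi (0 : ℝ))]
      fun x => p.eval x * p.eval x * airyWeight lam t x :=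
    (ae_restrict_iff' measurableSet_Ioi).2 (Eventually.of_forall fun x hx =>
      mul_nonneg (mul_self_nonneg _) (airyWeight_pos lam t hx).le)
  refine lt_of_le_of_ne (integral_nonneg_of_ae hnn) fun h => ?_
  have h0 := (integral_eq_zero_iff_of_nonneg_ae hnn (integrableOn_airyPairing hlam t p p)).1 h.symm
  have h1 := (ae_restrict_iff' measurableSet_Ioi).1 h0
  have hfin : volume {x : ℝ | p.IsRoot x} = 0 :=
    (finite_setOfPred_isRoot hp).measure_zero _
  have h2 : ∀ᵐ x : ℝ, ¬ p.IsRoot x := by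
    rw [ae_iff]; simpa using hfin
  have h3 : ∀ᵐ x : ℝ, x ∉ Set.Ioi (0 : ℝ) := by
    filter_upwards [h1, h2] with x hx hr hpos
    have hz : p.eval x * p.eval x * airyWeight lam t x = 0 := hx hpos
    rcases mul_eq_zero.1 hz with h4 | h4
    · exact hr (mul_self_eq_zero.1 h4)
    · exact (airyWeight_pos lam t hpos).ne' h4
  have h5 : volume (Set.Ioi (0 : ℝ)) = 0 := by
    rw [ae_iff] at h3
    exact measure_mono_null (fun x hx => not_not.2 hx) h3
  rw [Real.volume_Ioi] at h5
  exact ENNReal.top_ne_zero h5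

lemma airyPairing_airyPoly_self_pos {lam : ℝ} (hlam : -1 < lam) (t : ℝ) (n : ℕ) :
    0 < airyPairing lam t (airyPoly lam t n) (airyPoly lam t n) :=
  airyPairing_self_pos hlam t (airyPoly_monic lam t n).ne_zero

lemma airyPairing_airyPoly_of_lt {lam : ℝ} (hlam : -1 < lam) (t : ℝ) (n : ℕ) :
    ∀ m < n, airyPairing lam t (airyPoly lam t n) (airyPoly lam t m) = 0 := by
  induction n using Nat.strong_induction_on with
  | _ n ih =>
    intro m hm
    conv_lhs => rw [airyPoly]
    rw [airyPairing_sub_left hlam, airyPairing_sum_left hlam, Finset.sum_eq_single ⟨m, hm⟩]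
    · rw [airyPairing_C_mul_left,
        div_mul_cancel₀ _ (airyPairing_airyPoly_self_pos hlam t m).ne', sub_self]
    · intro k _ hk
      rw [airyPairing_C_mul_left]
      have hne : (k : ℕ) ≠ m := fun h => hk (Fin.ext h)
      rcases lt_or_gt_of_ne hne with h | h
      · rw [airyPairing_comm lam t (airyPoly lam t k) (airyPoly lam t m), ih m hm k h, mul_zero]
      · rw [ih k k.isLt m h, mul_zero]
    · intro h
      exact absurd (Finset.mem_univ _) h

/-- The polynomials `airyPoly lam t n` are pairwise orthogonal. -/
lemma airyPairing_airyPoly {lam : ℝ} (hlam : -1 < lam) (t : ℝ) {m n : ℕ} (h : m ≠ n) :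
    airyPairing lam t (airyPoly lam t m) (airyPoly lam t n) = 0 := by
  rcases lt_or_gt_of_ne h with h | h
  · rw [airyPairing_comm, airyPairing_airyPoly_of_lt hlam t n m h]
  · exact airyPairing_airyPoly_of_lt hlam t m n h

lemma airyPairing_eq_zero_of_degree_lt {lam : ℝ} (hlam : -1 < lam) (t : ℝ) (r : ℝ[X]) (n : ℕ)
    (hr : ∀ k < n, airyPairing lam t (airyPoly lam t k) r = 0) :
    ∀ p : ℝ[X], p.degree < n → airyPairing lam t p r = 0 := by
  induction n with
  | zero =>
    intro p hp
    have : p = 0 := by simpa using hp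
    simp [this, airyPairing]
  | succ n ih =>
    intro p hp
    have hd : (p - C (p.coeff n) * airyPoly lam t n).degree < n := by
      rw [degree_lt_iff_coeff_zero]
      intro m hm
      rcases hm.eq_or_lt with rfl | hm
      · have := (airyPoly_monic lam t n).coeff_natDegree
        rw [airyPoly_natDegree] at this
        simp [this]
      · have h1 : p.coeff m = 0 := (degree_lt_iff_coeff_zero p (n + 1)).1 hp m hm
        have h2 : (airyPoly lam t n).coeff m = 0 :=
          coeff_eq_zero_of_natDegree_lt (by rwa [airyPoly_natDegree])
        simp [h1, h2]
    have h0 := ih (fun k hk => hr k (hk.trans n.lt_succ_self)) _ hd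
    rw [airyPairing_sub_left hlam, airyPairing_C_mul_left, hr n n.lt_succ_self] at h0
    simpa using h0

/-- A pairwise orthogonal family of monic polynomials, one of each degree, is `airyPoly`. -/
lemma airyPoly_unique {lam : ℝ} (hlam : -1 < lam) (t : ℝ) (Q : ℕ → ℝ[X])
    (hmonic : ∀ n, (Q n).Monic) (hdeg : ∀ n, (Q n).natDegree = n)
    (horth : ∀ m n, m ≠ n → airyPairing lam t (Q m) (Q n) = 0) (n : ℕ) :
    Q n = airyPoly lam t n := by
  induction n using Nat.strong_induction_on with
  | _ n ih =>
    have hd : (Q n - airyPoly lam t n).degree < n := by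
      have h := degree_sub_lt_left (p := Q n) (q := airyPoly lam t n)
        (by rw [degree_eq_natDegree (hmonic n).ne_zero,
          degree_eq_natDegree (airyPoly_monic lam t n).ne_zero, hdeg, airyPoly_natDegree])
        (hmonic n).ne_zero
        (by rw [(hmonic n).leadingCoeff, (airyPoly_monic lam t n).leadingCoeff])
      rwa [degree_eq_natDegree (hmonic n).ne_zero, hdeg] at h
    by_contra hne
    refine (airyPairing_self_pos hlam t (sub_ne_zero.2 hne)).ne' ?_
    refine airyPairing_eq_zero_of_degree_lt hlam t _ n (fun k hk => ?_) _ hd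
    rw [airyPairing_comm, airyPairing_sub_left hlam, airyPairing_airyPoly hlam t hk.ne',
      ← ih k hk, horth n k hk.ne', sub_zero]

/-! The three-term recurrence `X P_n = P_{n+1} + α_n P_n + β_n P_{n-1}` gives `p(n,t) = -(α_0 + ...
+ α_{n-1})`, so it suffices to expand the `α_n`. The weight satisfies `(x w)' = (lam + 1 + t x -
x^3) w`. Testing this against `P_n^2` and `P_{n+1} P_n` yields two algebraic "string equations" for
`α` and `β` (`airyAlpha_string`, `airyBeta_string`), while `α_n > 0` and `β_n ≥ 0` come from
positivity of the weight.

After rescaling, the string equations become a solvable limiting system perturbed by a small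
parameter `ε`. Once the rescaled coefficients are known to be bounded, substituting the equations
into themselves determines the partial sums of the rescaled `α` up to `O(ε^2)`, which is the claimed
accuracy.

As `t → -∞`, the mass lies at scale `1/|t|` and the limit is the Laguerre weight, with `ε =
|t|^(-3)`. Boundedness follows from positivity, since every discarded term has a favourable sign
(`laguerre_expansion`, `airySubleading_atBot`).

As `t = s^2 → +∞`, the exponent has its maximum at `x = s` and the mass is Gaussian of variance
about `1/(2s)`. The limit is Hermite, with `α_n = s + A_n / s^2`, `β_n = B_n / s` and `ε = s^(-3)`
(`hermite_expansion`). Boundedness of `A` and `B` is the hard point, because the string equations by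
themselves do not exclude `α_n` near `0`. The additional input is a moment bound about `s`
(`exists_airyFunctional_shift_le`), itself obtained from integration by parts. It gives `α_0 ≥ s/2`
and upper bounds on the norms; the string equations give lower bounds on the norms. Hence `β_n =
O(1/s)` (`exists_airyBeta_le`), and an induction on `n` rules out the small branch
(`eventually_airyAlpha_ge`). -/

/-! ### Recurrence coefficients. -/

/-- Integration of a polynomial against the generalized Airy weight. -/
noncomputable def airyFunctional {lam : ℝ} (hlam : -1 < lam) (t : ℝ) : ℝ[X] →ₗ[ℝ] ℝ where
  toFun p := ∫ x in Set.Ioi (0 : ℝ), p.eval x * airyWeight lam t x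
  map_add' p q := by
    simp only [eval_add, add_mul]
    exact integral_add (integrableOn_eval_mul_airyWeight hlam t p)
      (integrableOn_eval_mul_airyWeight hlam t q)
  map_smul' a p := by
    simp only [eval_smul, smul_eq_mul, mul_assoc, RingHom.id_apply]
    exact integral_const_mul _ _

/-- The squared norm of the `n`-th monic orthogonal polynomial. -/
noncomputable def airyNorm (lam t : ℝ) (n : ℕ) : ℝ :=
  airyPairing lam t (airyPoly lam t n) (airyPoly lam t n)

/-- The diagonal recurrence coefficient. -/
noncomputable def airyAlpha (lam t : ℝ) (n : ℕ) : ℝ :=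
  airyPairing lam t (X * airyPoly lam t n) (airyPoly lam t n) / airyNorm lam t n

/-- The off-diagonal recurrence coefficient, with value `0` at `n = 0`. -/
noncomputable def airyBeta (lam t : ℝ) (n : ℕ) : ℝ :=
  if n = 0 then 0 else airyNorm lam t n / airyNorm lam t (n - 1)

section

variable {lam : ℝ} (hlam : -1 < lam) (t : ℝ)

lemma airyPairing_eq_functional (p q : ℝ[X]) :
    airyPairing lam t p q = airyFunctional hlam t (p * q) := by
  simp [airyPairing, airyFunctional]

lemma airyFunctional_C_mul (a : ℝ) (p : ℝ[X]) :
    airyFunctional hlam t (C a * p) = a * airyFunctional hlam t p := by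
  rw [← smul_eq_C_mul, map_smul, smul_eq_mul]

lemma airyFunctional_nonneg {p : ℝ[X]} (hp : ∀ x, 0 < x → 0 ≤ p.eval x) :
    0 ≤ airyFunctional hlam t p :=
  setIntegral_nonneg measurableSet_Ioi fun x hx =>
    mul_nonneg (hp x hx) (airyWeight_pos lam t hx).le

lemma airyFunctional_mono {p q : ℝ[X]} (hp : ∀ x, 0 < x → p.eval x ≤ q.eval x) :
    airyFunctional hlam t p ≤ airyFunctional hlam t q := by
  have := airyFunctional_nonneg hlam t (p := q - p) fun x hx => by
    rw [eval_sub]; exact sub_nonneg.2 (hp x hx)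
  rw [map_sub] at this
  linarith

include hlam in
lemma airyNorm_pos (n : ℕ) : 0 < airyNorm lam t n := airyPairing_airyPoly_self_pos hlam t n

include hlam in
-- A factor `x` in the integrand raises the exponent of the weight from `lam` to `lam + 1`, so the
-- numerator is again a squared norm.
lemma airyAlpha_pos (n : ℕ) : 0 < airyAlpha lam t n := by
  refine div_pos ?_ (airyNorm_pos hlam t n)
  have h := airyPairing_self_pos (lam := lam + 1) (by linarith) t (airyPoly_monic lam t n).ne_zero
  suffices e : airyPairing lam t (X * airyPoly lam t n) (airyPoly lam t n) =
      airyPairing (lam + 1) t (airyPoly lam t n) (airyPoly lam t n) by rwa [e]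
  unfold airyPairing
  refine setIntegral_congr_fun measurableSet_Ioi fun x hx => ?_
  have : x ^ (lam + 1) = x ^ lam * x := by rw [Real.rpow_add hx, Real.rpow_one]
  simp only [eval_mul, eval_X, airyWeight, this]
  ring

include hlam in
lemma airyBeta_nonneg (n : ℕ) : 0 ≤ airyBeta lam t n := by
  unfold airyBeta
  split_ifs
  · exact le_rfl
  · exact (div_pos (airyNorm_pos hlam t _) (airyNorm_pos hlam t _)).le

lemma airyBeta_zero : airyBeta lam t 0 = 0 := by simp [airyBeta]

include hlam in
lemma airyBeta_succ_mul (n : ℕ) :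
    airyBeta lam t (n + 1) * airyNorm lam t n = airyNorm lam t (n + 1) := by
  simp [airyBeta, (airyNorm_pos hlam t n).ne']

/-- Subtracting the multiple of `P_n` with the same `x^n` coefficient leaves degree below `n`,
orthogonal to `P_n`. Most matrix elements below thereby reduce to reading off one coefficient. -/
lemma airyFunctional_mul_airyPoly {p : ℝ[X]} {n : ℕ} (hp : p.degree ≤ n) :
    airyFunctional hlam t (p * airyPoly lam t n) = p.coeff n * airyNorm lam t n := by
  have hd : (p - C (p.coeff n) * airyPoly lam t n).degree < n := by
    rw [degree_lt_iff_coeff_zero]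
    intro m hm
    rcases hm.eq_or_lt with rfl | hm
    · have := (airyPoly_monic lam t n).coeff_natDegree
      rw [airyPoly_natDegree] at this
      simp [this]
    · have h1 : p.coeff m = 0 :=
        coeff_eq_zero_of_degree_lt (hp.trans_lt (by exact_mod_cast hm))
      have h2 : (airyPoly lam t n).coeff m = 0 :=
        coeff_eq_zero_of_natDegree_lt (by rwa [airyPoly_natDegree])
      simp [h1, h2]
  have h := airyPairing_eq_zero_of_degree_lt hlam t (airyPoly lam t n) n
    (fun k hk => airyPairing_airyPoly hlam t hk.ne) _ hd
  rw [airyPairing_sub_left hlam, airyPairing_C_mul_left, airyPairing_eq_functional hlam] at h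
  rw [airyNorm]
  linarith

lemma airyPoly_degree (n : ℕ) : (airyPoly lam t n).degree = n := by
  rw [degree_eq_natDegree (airyPoly_monic lam t n).ne_zero, airyPoly_natDegree]

lemma airyPoly_coeff_self (n : ℕ) : (airyPoly lam t n).coeff n = 1 := by
  simpa [airyPoly_natDegree] using (airyPoly_monic lam t n).coeff_natDegree

lemma airyFunctional_airyPoly_mul {m n : ℕ} (h : m ≠ n) :
    airyFunctional hlam t (airyPoly lam t m * airyPoly lam t n) = 0 := by
  rw [← airyPairing_eq_functional, airyPairing_airyPoly hlam t h]

lemma airyFunctional_airyPoly_sq (n : ℕ) :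
    airyFunctional hlam t (airyPoly lam t n * airyPoly lam t n) = airyNorm lam t n := by
  rw [← airyPairing_eq_functional, airyNorm]

lemma airyFunctional_X_mul_sq (n : ℕ) :
    airyFunctional hlam t (X * airyPoly lam t n * airyPoly lam t n) =
      airyAlpha lam t n * airyNorm lam t n := by
  rw [← airyPairing_eq_functional, airyAlpha, div_mul_cancel₀ _ (airyNorm_pos hlam t n).ne']

lemma degree_X_mul_airyPoly (n : ℕ) : (X * airyPoly lam t n).degree = ((n + 1 : ℕ) : WithBot ℕ) := by
  rw [degree_mul, airyPoly_degree, degree_X, add_comm]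
  rfl

lemma airyFunctional_X_mul_succ (n : ℕ) :
    airyFunctional hlam t (X * airyPoly lam t n * airyPoly lam t (n + 1)) =
      airyNorm lam t (n + 1) := by
  rw [airyFunctional_mul_airyPoly hlam t (degree_X_mul_airyPoly t n).le, coeff_X_mul,
    airyPoly_coeff_self, one_mul]

lemma airyFunctional_X_mul_of_lt {m n : ℕ} (h : m + 1 < n) :
    airyFunctional hlam t (X * airyPoly lam t m * airyPoly lam t n) = 0 := by
  have hd : (X * airyPoly lam t m).degree < (n : WithBot ℕ) := by
    rw [degree_X_mul_airyPoly]; exact_mod_cast h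
  rw [airyFunctional_mul_airyPoly hlam t hd.le, coeff_eq_zero_of_degree_lt hd, zero_mul]

include hlam in
/-- The three-term recurrence. -/
lemma X_mul_airyPoly (n : ℕ) :
    X * airyPoly lam t n = airyPoly lam t (n + 1) + C (airyAlpha lam t n) * airyPoly lam t n +
      C (airyBeta lam t n) * airyPoly lam t (n - 1) := by
  set R := X * airyPoly lam t n - airyPoly lam t (n + 1) -
    (C (airyAlpha lam t n) * airyPoly lam t n + C (airyBeta lam t n) * airyPoly lam t (n - 1))
    with hR
  have hd : R.degree < (n + 1 : ℕ) := by
    refine (degree_sub_le _ _).trans_lt (max_lt ?_ ?_)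
    · have h := degree_sub_lt_left (p := X * airyPoly lam t n) (q := airyPoly lam t (n + 1))
        (by rw [degree_X_mul_airyPoly, airyPoly_degree])
        (monic_X.mul (airyPoly_monic lam t n)).ne_zero
        (by rw [(monic_X.mul (airyPoly_monic lam t n)).leadingCoeff,
          (airyPoly_monic lam t (n + 1)).leadingCoeff])
      rwa [degree_X_mul_airyPoly] at h
    · refine (degree_add_le _ _).trans_lt (max_lt ?_ ?_)
      · rw [← smul_eq_C_mul]
        refine (degree_smul_le _ _).trans_lt ?_
        rw [airyPoly_degree]
        exact_mod_cast n.lt_succ_self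
      · rw [← smul_eq_C_mul]
        refine (degree_smul_le _ _).trans_lt ?_
        rw [airyPoly_degree]
        exact_mod_cast (Nat.sub_le n 1).trans_lt n.lt_succ_self
  -- `R` has degree at most `n`; orthogonality to `P_0, ..., P_n` makes it orthogonal to itself,
  -- hence zero.
  have horth : ∀ k < n + 1, airyPairing lam t (airyPoly lam t k) R = 0 := by
    intro k hk
    rw [airyPairing_eq_functional hlam]
    have e : airyPoly lam t k * R = X * airyPoly lam t k * airyPoly lam t n
        - airyPoly lam t k * airyPoly lam t (n + 1)
        - (C (airyAlpha lam t n) * (airyPoly lam t k * airyPoly lam t n)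
          + C (airyBeta lam t n) * (airyPoly lam t k * airyPoly lam t (n - 1))) := by
      rw [hR]; ring
    rw [e, map_sub, map_sub, map_add, airyFunctional_C_mul, airyFunctional_C_mul,
      airyFunctional_airyPoly_mul hlam t hk.ne]
    rcases Nat.lt_succ_iff_lt_or_eq.1 hk with h | rfl
    · obtain ⟨m, rfl⟩ : ∃ m, n = m + 1 := ⟨n - 1, by omega⟩
      rw [airyFunctional_airyPoly_mul hlam t h.ne, Nat.add_sub_cancel]
      rcases Nat.lt_succ_iff_lt_or_eq.1 h with h' | rfl
      · rw [airyFunctional_airyPoly_mul hlam t h'.ne,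
          airyFunctional_X_mul_of_lt hlam t (by omega)]
        ring
      · rw [airyFunctional_X_mul_succ, airyFunctional_airyPoly_sq, airyBeta_succ_mul hlam]
        ring
    · rw [airyFunctional_X_mul_sq, airyFunctional_airyPoly_sq]
      rcases Nat.eq_zero_or_pos k with rfl | hk0
      · rw [airyBeta_zero]; ring
      · rw [airyFunctional_airyPoly_mul hlam t (by omega)]; ring
  have h0 := airyPairing_eq_zero_of_degree_lt hlam t R (n + 1) horth R hd
  have hR0 : R = 0 := by
    by_contra h
    exact (airyPairing_self_pos hlam t h).ne' h0
  linear_combination hR.symm.trans hR0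

include hlam in
-- Comparison of the coefficients of `x^n` in the three-term recurrence; `β_0 = 0` and the
-- convention `p(0,t) = 0` cover `n = 0`.
lemma airySubleading_succ (n : ℕ) :
    airySubleading lam (n + 1) t = airySubleading lam n t - airyAlpha lam t n := by
  have h := congrArg (fun p => p.coeff n) (X_mul_airyPoly hlam t n)
  rcases n with _ | m
  · have h2 : (airyPoly lam t 0).coeff 0 = 1 := airyPoly_coeff_self t 0
    simp only [coeff_add, airyBeta_zero, h2, mul_coeff_zero, coeff_X_zero, coeff_C_zero,
      Nat.zero_add] at h
    simp only [airySubleading, Nat.zero_add, one_ne_zero, if_false, if_true, Nat.sub_self]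
    linarith
  · have h3 : (airyPoly lam t m).coeff (m + 1) = 0 :=
      coeff_eq_zero_of_natDegree_lt (by simp [airyPoly_natDegree])
    simp only [coeff_add, coeff_C_mul, coeff_X_mul, airyPoly_coeff_self, Nat.add_sub_cancel,
      h3] at h
    simp only [airySubleading, Nat.succ_ne_zero, if_false, Nat.add_sub_cancel]
    linarith

include hlam in
lemma airySubleading_eq_neg_sum (n : ℕ) :
    airySubleading lam n t = -∑ j ∈ Finset.range n, airyAlpha lam t j := by
  induction n with
  | zero => simp [airySubleading]
  | succ n ih => rw [airySubleading_succ hlam, ih, Finset.sum_range_succ]; ring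

/-! ### Integration by parts and the string equations. -/

/-- Integration by parts against `x * w(x)`. -/
lemma airyFunctional_by_parts (q : ℝ[X]) :
    airyFunctional hlam t (X * derivative q + C (lam + 1) * q + C t * (X * q) - X ^ 3 * q) = 0 := by
  set r := X * derivative q + C (lam + 1) * q + C t * (X * q) - X ^ 3 * q with hr
  set F : ℝ → ℝ := fun x => q.eval x * (x ^ (lam + 1) * Real.exp (-(1 / 3) * x ^ 3 + t * x))
    with hF
  have hderiv : ∀ x ∈ Set.Ioi (0 : ℝ), HasDerivAt F (r.eval x * airyWeight lam t x) x := by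
    intro x hx
    have hx : 0 < x := hx
    have h1 := q.hasDerivAt x
    have h2 : HasDerivAt (fun x : ℝ => x ^ (lam + 1)) ((lam + 1) * x ^ lam) x := by
      simpa using Real.hasDerivAt_rpow_const (p := lam + 1) (Or.inl hx.ne')
    have h3 : HasDerivAt (fun x : ℝ => -(1 / 3) * x ^ 3 + t * x) (-x ^ 2 + t) x := by
      refine (((hasDerivAt_pow 3 x).const_mul (-(1 / 3 : ℝ))).add
        ((hasDerivAt_id x).const_mul t)).congr_deriv ?_
      norm_num
      ring
    refine (h1.mul (h2.mul h3.exp)).congr_deriv ?_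
    have : x ^ (lam + 1) = x ^ lam * x := by rw [Real.rpow_add hx, Real.rpow_one]
    simp only [hr, eval_sub, eval_add, eval_mul, eval_X, eval_C, eval_pow, airyWeight,
      Pi.mul_apply, this]
    ring
  -- The extra factor `x` makes the exponent `lam + 1` positive, so `F` is continuous at `0` with no
  -- boundary term there.
  have hcont : ContinuousWithinAt F (Set.Ici 0) 0 := by
    have : Continuous F := by
      have h1 : Continuous fun x : ℝ => x ^ (lam + 1) :=
        Real.continuous_rpow_const (by linarith)
      have h2 : Continuous fun x => q.eval x := q.continuous
      fun_prop
    exact this.continuousWithinAt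
  have hint := integrableOn_eval_mul_airyWeight hlam t r
  have hFint : IntegrableOn F (Set.Ioi 0) := by
    refine (integrableOn_eval_mul_airyWeight hlam t (X * q)).congr_fun (fun x hx => ?_)
      measurableSet_Ioi
    have : x ^ (lam + 1) = x ^ lam * x := by rw [Real.rpow_add hx, Real.rpow_one]
    simp only [hF, eval_mul, eval_X, airyWeight, this]
    ring
  -- No growth estimate is needed at infinity: `F` and its derivative are both integrable.
  have htend : Tendsto F atTop (nhds 0) :=
    tendsto_zero_of_hasDerivAt_of_integrableOn_Ioi hderiv hint hFint
  have h := integral_Ioi_of_hasDerivAt_of_tendsto hcont hderiv hint htend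
  have h0 : F 0 = 0 := by simp [hF, Real.zero_rpow (by linarith : lam + 1 ≠ 0)]
  rw [h0, sub_zero] at h
  exact h

end

section

variable {lam : ℝ} (hlam : -1 < lam) (t : ℝ)

lemma airyFunctional_X_mul_airyPoly_derivative (n : ℕ) :
    airyFunctional hlam t (X * derivative (airyPoly lam t n) * airyPoly lam t n) =
      n * airyNorm lam t n := by
  have hd : (X * derivative (airyPoly lam t n)).degree ≤ (n : WithBot ℕ) := by
    refine degree_le_of_natDegree_le ?_
    rw [natDegree_le_iff_coeff_eq_zero]
    intro m hm
    obtain ⟨k, rfl⟩ : ∃ k, m = k + 1 := ⟨m - 1, by omega⟩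
    rw [coeff_X_mul, coeff_derivative,
      coeff_eq_zero_of_natDegree_lt (by rwa [airyPoly_natDegree]), zero_mul]
  rw [airyFunctional_mul_airyPoly hlam t hd]
  congr 1
  rcases n with _ | n
  · simp
  · rw [coeff_X_mul, coeff_derivative, airyPoly_coeff_self]
    push_cast; ring

lemma airyFunctional_X_mul_airyPoly_derivative_succ (n : ℕ) :
    airyFunctional hlam t (X * derivative (airyPoly lam t n) * airyPoly lam t (n + 1)) = 0 := by
  have hd : (X * derivative (airyPoly lam t n)).degree ≤ ((n + 1 : ℕ) : WithBot ℕ) := by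
    refine degree_le_of_natDegree_le ?_
    rw [natDegree_le_iff_coeff_eq_zero]
    intro m hm
    obtain ⟨k, rfl⟩ : ∃ k, m = k + 1 := ⟨m - 1, by omega⟩
    rw [coeff_X_mul, coeff_derivative,
      coeff_eq_zero_of_natDegree_lt (by rw [airyPoly_natDegree]; omega), zero_mul]
  rw [airyFunctional_mul_airyPoly hlam t hd, coeff_X_mul, coeff_derivative,
    coeff_eq_zero_of_natDegree_lt (by rw [airyPoly_natDegree]; omega), zero_mul, zero_mul]

/-- The Euler operator multiplies `x^m` by `m`, so `X P' - (n+1) P` loses its leading term and has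
`x^n` coefficient `-p(n+1,t)`. This is how the sub-leading coefficient enters the off-diagonal
string equation. -/
lemma airyFunctional_X_mul_airyPoly_succ_derivative (n : ℕ) :
    airyFunctional hlam t (X * derivative (airyPoly lam t (n + 1)) * airyPoly lam t n) =
      -airySubleading lam (n + 1) t * airyNorm lam t n := by
  set P := airyPoly lam t (n + 1) with hP
  have hc : ∀ m, (X * derivative P - C ((n : ℝ) + 1) * P).coeff m =
      (m - (n + 1)) * P.coeff m := by
    intro m
    rcases m with _ | m
    · simp; ring
    · rw [coeff_sub, coeff_X_mul, coeff_derivative, coeff_C_mul]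
      push_cast; ring
  have hd : (X * derivative P - C ((n : ℝ) + 1) * P).degree ≤ (n : WithBot ℕ) := by
    refine degree_le_of_natDegree_le ?_
    rw [natDegree_le_iff_coeff_eq_zero]
    intro m hm
    rw [hc]
    rcases (Nat.succ_le_of_lt hm).eq_or_lt with h | h
    · subst h; push_cast; ring
    · rw [coeff_eq_zero_of_natDegree_lt (by rw [hP, airyPoly_natDegree]; exact h), mul_zero]
  have h := airyFunctional_mul_airyPoly hlam t hd
  rw [hc, sub_mul, map_sub, mul_assoc (C _), airyFunctional_C_mul,
    airyFunctional_airyPoly_mul hlam t (Nat.succ_ne_self n)] at h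
  simp only [airySubleading, Nat.succ_ne_zero, if_false, Nat.add_sub_cancel]
  linear_combination h

/-- The matrix entries of multiplication by `X ^ 3` on the diagonal. -/
lemma airyFunctional_X_pow_three_mul_sq (n : ℕ) :
    airyFunctional hlam t (X ^ 3 * (airyPoly lam t n * airyPoly lam t n)) =
      (airyAlpha lam t n ^ 3
        + 2 * airyAlpha lam t n * (airyBeta lam t n + airyBeta lam t (n + 1))
        + airyAlpha lam t (n - 1) * airyBeta lam t n
        + airyAlpha lam t (n + 1) * airyBeta lam t (n + 1)) * airyNorm lam t n := by
  set P := airyPoly lam t with hP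
  set a := airyAlpha lam t with ha
  set b := airyBeta lam t with hb
  -- Written as `X (X P_n)^2` with each `X P_n` expanded by the recurrence, the product involves
  -- only matrix elements of multiplication by `X`.
  have e : X ^ 3 * (P n * P n) = X * P (n + 1) * P (n + 1) + C (a n ^ 2) * (X * P n * P n)
      + C (b n ^ 2) * (X * P (n - 1) * P (n - 1)) + C (2 * a n) * (X * P n * P (n + 1))
      + C (2 * (a n * b n)) * (X * P (n - 1) * P n)
      + C (2 * b n) * (X * P (n - 1) * P (n + 1)) := by
    have h := X_mul_airyPoly hlam t n
    rw [← hP, ← ha, ← hb] at h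
    simp only [C_mul, C_pow, map_ofNat]
    linear_combination
      X * (X * P n + (P (n + 1) + C (a n) * P n + C (b n) * P (n - 1))) * h
  rw [e]
  simp only [map_add, airyFunctional_C_mul]
  rw [airyFunctional_X_mul_sq, airyFunctional_X_mul_sq, airyFunctional_X_mul_sq,
    airyFunctional_X_mul_succ, ← airyBeta_succ_mul hlam t n]
  -- At `n = 0` truncated subtraction turns `P_{-1}` into `P_0`, but each such term carries a factor
  -- `β_0 = 0`.
  rcases n with _ | m
  · simp only [hb, airyBeta_zero]; ring
  · rw [Nat.add_sub_cancel, airyFunctional_X_mul_succ, airyFunctional_X_mul_of_lt hlam t (by omega),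
      ← airyBeta_succ_mul hlam t m]
    ring

/-- The matrix entries of multiplication by `X ^ 3` next to the diagonal. -/
lemma airyFunctional_X_pow_three_mul_succ (n : ℕ) :
    airyFunctional hlam t (X ^ 3 * (airyPoly lam t (n + 1) * airyPoly lam t n)) =
      airyBeta lam t (n + 1) * (airyAlpha lam t (n + 1) ^ 2
        + airyAlpha lam t (n + 1) * airyAlpha lam t n + airyAlpha lam t n ^ 2
        + airyBeta lam t (n + 2) + airyBeta lam t (n + 1) + airyBeta lam t n)
        * airyNorm lam t n := by
  set P := airyPoly lam t with hP
  set a := airyAlpha lam t with ha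
  set b := airyBeta lam t with hb
  have e : X ^ 3 * (P (n + 1) * P n) = X * P (n + 1) * P (n + 2) + C (a n) * (X * P n * P (n + 2))
      + C (b n) * (X * P (n - 1) * P (n + 2))
      + C (a (n + 1)) * (X * P (n + 1) * P (n + 1)) + C (a (n + 1) * a n) * (X * P n * P (n + 1))
      + C (a (n + 1) * b n) * (X * P (n - 1) * P (n + 1))
      + C (b (n + 1)) * (X * P n * P (n + 1)) + C (b (n + 1) * a n) * (X * P n * P n)
      + C (b (n + 1) * b n) * (X * P (n - 1) * P n) := by
    have h := X_mul_airyPoly hlam t n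
    have h' := X_mul_airyPoly hlam t (n + 1)
    rw [Nat.add_sub_cancel] at h'
    rw [← hP, ← ha, ← hb] at h h'
    simp only [C_mul]
    linear_combination X * (X * P n) * h' +
      X * (P (n + 2) + C (a (n + 1)) * P (n + 1) + C (b (n + 1)) * P n) * h
  rw [e]
  simp only [map_add, airyFunctional_C_mul]
  rw [airyFunctional_X_mul_sq, airyFunctional_X_mul_sq,
    airyFunctional_X_mul_succ, airyFunctional_X_mul_succ,
    airyFunctional_X_mul_of_lt hlam t (show n + 1 < n + 2 by omega),
    airyFunctional_X_mul_of_lt hlam t (show n - 1 + 1 < n + 2 by omega),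
    ← airyBeta_succ_mul hlam t (n + 1), ← airyBeta_succ_mul hlam t n]
  rcases n with _ | m
  · simp only [hb, airyBeta_zero]; ring
  · rw [Nat.add_sub_cancel, airyFunctional_X_mul_succ, airyFunctional_X_mul_of_lt hlam t (by omega),
      ← airyBeta_succ_mul hlam t m]
    ring

include hlam in
/-- The diagonal string equation. -/
lemma airyAlpha_string (n : ℕ) :
    airyAlpha lam t n ^ 3 + 2 * airyAlpha lam t n * (airyBeta lam t n + airyBeta lam t (n + 1))
      + airyAlpha lam t (n - 1) * airyBeta lam t n
      + airyAlpha lam t (n + 1) * airyBeta lam t (n + 1) =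
      t * airyAlpha lam t n + (2 * n + 1 + lam) := by
  have h := airyFunctional_by_parts hlam t (airyPoly lam t n * airyPoly lam t n)
  have e : X * derivative (airyPoly lam t n * airyPoly lam t n) =
      C 2 * (X * derivative (airyPoly lam t n) * airyPoly lam t n) := by
    rw [derivative_mul, map_ofNat]; ring
  rw [e, ← mul_assoc X (airyPoly lam t n), map_sub, map_add, map_add, airyFunctional_C_mul,
    airyFunctional_C_mul, airyFunctional_C_mul, airyFunctional_X_pow_three_mul_sq,
    airyFunctional_X_mul_airyPoly_derivative, airyFunctional_X_mul_sq,
    airyFunctional_airyPoly_sq] at h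
  refine mul_right_cancel₀ (airyNorm_pos hlam t n).ne' ?_
  linear_combination -h

include hlam in
/-- The off-diagonal string equation. -/
lemma airyBeta_string (n : ℕ) :
    airyBeta lam t n * (airyAlpha lam t n ^ 2 + airyAlpha lam t n * airyAlpha lam t (n - 1)
      + airyAlpha lam t (n - 1) ^ 2 + airyBeta lam t (n + 1) + airyBeta lam t n
      + airyBeta lam t (n - 1) - t) = ∑ j ∈ Finset.range n, airyAlpha lam t j := by
  rcases n with _ | n
  · simp [airyBeta_zero]
  rw [Nat.add_sub_cancel]
  have h := airyFunctional_by_parts hlam t (airyPoly lam t (n + 1) * airyPoly lam t n)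
  have e : X * derivative (airyPoly lam t (n + 1) * airyPoly lam t n) =
      X * derivative (airyPoly lam t (n + 1)) * airyPoly lam t n
        + X * derivative (airyPoly lam t n) * airyPoly lam t (n + 1) := by
    rw [derivative_mul]; ring
  have e' : X * (airyPoly lam t (n + 1) * airyPoly lam t n) =
      X * airyPoly lam t n * airyPoly lam t (n + 1) := by ring
  rw [e, e', map_sub, map_add, map_add, map_add, airyFunctional_C_mul, airyFunctional_C_mul,
    airyFunctional_X_pow_three_mul_succ, airyFunctional_X_mul_airyPoly_succ_derivative,
    airyFunctional_X_mul_airyPoly_derivative_succ, airyFunctional_X_mul_succ,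
    airyFunctional_airyPoly_mul hlam t (Nat.succ_ne_self n), airySubleading_eq_neg_sum hlam,
    ← airyBeta_succ_mul hlam t n] at h
  refine mul_right_cancel₀ (airyNorm_pos hlam t n).ne' ?_
  linear_combination -h

end

/-! ### Perturbative solution of the rescaled string equations. -/

section Expansion

variable {l : Filter ℝ} {ε f g : ℝ → ℝ} {c d : ℝ}

/-- `f` equals the constant `c` up to an error of order `ε`. -/
def NearConst (l : Filter ℝ) (ε f : ℝ → ℝ) (c : ℝ) : Prop :=
  (fun t => f t - c) =O[l] ε

lemma NearConst.isBigO_one (hε : ε =O[l] (1 : ℝ → ℝ)) (hf : NearConst l ε f c) :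
    f =O[l] (1 : ℝ → ℝ) := by
  have h : f = fun t => (f t - c) + c := by funext t; ring
  rw [h]
  exact (IsBigO.trans hf hε).add (isBigO_const_const c one_ne_zero l)

lemma nearConst_const (c : ℝ) : NearConst l ε (fun _ => c) c := by
  simpa [NearConst] using isBigO_zero ε l

lemma NearConst.add (hf : NearConst l ε f c) (hg : NearConst l ε g d) :
    NearConst l ε (fun t => f t + g t) (c + d) :=
  (IsBigO.add hf hg).congr_left fun t => by ring

lemma NearConst.sub (hf : NearConst l ε f c) (hg : NearConst l ε g d) :
    NearConst l ε (fun t => f t - g t) (c - d) :=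
  (IsBigO.sub hf hg).congr_left fun t => by ring

lemma NearConst.const_mul (a : ℝ) (hf : NearConst l ε f c) :
    NearConst l ε (fun t => a * f t) (a * c) :=
  (IsBigO.const_mul_left hf a).congr_left fun t => by ring

lemma NearConst.mul (hε : ε =O[l] (1 : ℝ → ℝ)) (hf : NearConst l ε f c)
    (hg : NearConst l ε g d) : NearConst l ε (fun t => f t * g t) (c * d) := by
  have h1 : (fun t => (f t - c) * g t) =O[l] ε := by
    simpa using IsBigO.mul hf (hg.isBigO_one hε)
  exact (h1.add (IsBigO.const_mul_left hg c)).congr_left fun t => by ring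

lemma NearConst.sum {ι : Type*} (s : Finset ι) {f : ι → ℝ → ℝ} {c : ι → ℝ}
    (hf : ∀ i ∈ s, NearConst l ε (f i) (c i)) :
    NearConst l ε (fun t => ∑ i ∈ s, f i t) (∑ i ∈ s, c i) :=
  (IsBigO.sum hf).congr_left fun t => by rw [Finset.sum_apply, Finset.sum_sub_distrib]

lemma nearConst_eps_mul (hf : f =O[l] (1 : ℝ → ℝ)) : NearConst l ε (fun t => ε t * f t) 0 := by
  simpa [NearConst] using (isBigO_refl ε l).mul hf

lemma NearConst.congr' (hf : NearConst l ε f c) (h : f =ᶠ[l] g) : NearConst l ε g c :=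
  IsBigO.congr' hf (h.mono fun t ht => by simp only [ht]) EventuallyEq.rfl

/-- The diagonal entries of the cube of the tridiagonal matrix with diagonal `a` and
off-diagonal products `b`. -/
def cubeDiag (a b : ℕ → ℝ) (n : ℕ) : ℝ :=
  a n ^ 3 + 2 * a n * (b n + b (n + 1)) + a (n - 1) * b n + a (n + 1) * b (n + 1)

/-- The subdiagonal entries of the cube of the tridiagonal matrix with diagonal `a`,
subdiagonal `b` and superdiagonal `1`. -/
def cubeOff (a b : ℕ → ℝ) (n : ℕ) : ℝ :=
  b n * (a n ^ 2 + a n * a (n - 1) + a (n - 1) ^ 2 + b (n + 1) + b n + b (n - 1))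

lemma NearConst.pow (hε : ε =O[l] (1 : ℝ → ℝ)) (hf : NearConst l ε f c) (k : ℕ) :
    NearConst l ε (fun t => f t ^ k) (c ^ k) := by
  induction k with
  | zero => simpa using nearConst_const (l := l) (ε := ε) 1
  | succ k ih => simpa only [pow_succ] using ih.mul hε hf

lemma isBigO_one_pow (hf : f =O[l] (1 : ℝ → ℝ)) (k : ℕ) :
    (fun t => f t ^ k) =O[l] (1 : ℝ → ℝ) := by
  exact (hf.pow k).congr_right fun _ => one_pow k

lemma isBigO_one_mul (hf : f =O[l] (1 : ℝ → ℝ)) (hg : g =O[l] (1 : ℝ → ℝ)) :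
    (fun t => f t * g t) =O[l] (1 : ℝ → ℝ) := by
  exact (hf.mul hg).congr_right fun _ => one_mul 1

variable {A B : ℕ → ℝ → ℝ} {a b : ℕ → ℝ}

lemma cubeDiag_isBigO_one (hA : ∀ n, A n =O[l] (1 : ℝ → ℝ)) (hB : ∀ n, B n =O[l] (1 : ℝ → ℝ))
    (n : ℕ) : (fun t => cubeDiag (A · t) (B · t) n) =O[l] (1 : ℝ → ℝ) := by
  unfold cubeDiag
  exact (((isBigO_one_pow (hA n) 3).add
    (isBigO_one_mul ((hA n).const_mul_left 2) ((hB n).add (hB (n + 1))))).add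
    (isBigO_one_mul (hA _) (hB _))).add (isBigO_one_mul (hA _) (hB _))

lemma cubeOff_isBigO_one (hA : ∀ n, A n =O[l] (1 : ℝ → ℝ)) (hB : ∀ n, B n =O[l] (1 : ℝ → ℝ))
    (n : ℕ) : (fun t => cubeOff (A · t) (B · t) n) =O[l] (1 : ℝ → ℝ) := by
  unfold cubeOff
  exact isBigO_one_mul (hB n) ((((((isBigO_one_pow (hA n) 2).add
    (isBigO_one_mul (hA _) (hA _))).add (isBigO_one_pow (hA _) 2)).add (hB _)).add (hB _)).add
    (hB _))

lemma NearConst.cubeDiag (hε : ε =O[l] (1 : ℝ → ℝ)) (hA : ∀ n, NearConst l ε (A n) (a n))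
    (hB : ∀ n, NearConst l ε (B n) (b n)) (n : ℕ) :
    NearConst l ε (fun t => _root_.cubeDiag (A · t) (B · t) n) (_root_.cubeDiag a b n) := by
  unfold _root_.cubeDiag
  exact ((((hA n).pow hε 3).add
    (((hA n).const_mul 2).mul hε ((hB n).add (hB (n + 1))))).add
    ((hA _).mul hε (hB _))).add ((hA _).mul hε (hB _))

/-- Solutions of the perturbed Laguerre string equations, to second order. -/
lemma laguerre_expansion (hε : ε =O[l] (1 : ℝ → ℝ)) (lam : ℝ)
    (hA : ∀ n, A n =O[l] (1 : ℝ → ℝ)) (hB : ∀ n, B n =O[l] (1 : ℝ → ℝ))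
    (h1 : ∀ n, ∀ᶠ t in l, A n t + ε t * cubeDiag (A · t) (B · t) n = 2 * n + 1 + lam)
    (h2 : ∀ n, ∀ᶠ t in l, B n t + ε t * cubeOff (A · t) (B · t) n = ∑ j ∈ Finset.range n, A j t)
    (n : ℕ) :
    (fun t => ∑ j ∈ Finset.range n, A j t - (n * (n + lam) -
      ε t * (n * (n + lam) * (5 * n ^ 2 + 5 * n * lam + lam ^ 2 + 1)))) =O[l]
      fun t => ε t ^ 2 := by
  -- At `ε = 0` the system is solved by the Laguerre coefficients `2n + 1 + lam` and `n (n + lam)`;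
  -- boundedness alone makes the perturbation `O(ε)`.
  have hA0 : ∀ n : ℕ, NearConst l ε (A n) (2 * n + 1 + lam) := fun n => by
    have := (nearConst_const (l := l) (ε := ε) (2 * n + 1 + lam)).sub
      (nearConst_eps_mul (cubeDiag_isBigO_one hA hB n))
    rw [sub_zero] at this
    exact this.congr' ((h1 n).mono fun t ht => by linarith)
  have hsum : ∀ n : ℕ, ∑ j ∈ Finset.range n, (2 * (j : ℝ) + 1 + lam) = n * (n + lam) := by
    intro n
    induction n with
    | zero => simp
    | succ n ih => rw [Finset.sum_range_succ, ih]; push_cast; ring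
  have hB0 : ∀ n : ℕ, NearConst l ε (B n) (n * (n + lam)) := fun n => by
    have := (NearConst.sum (Finset.range n) fun j _ => hA0 j).sub
      (nearConst_eps_mul (cubeOff_isBigO_one hA hB n))
    rw [sub_zero, hsum] at this
    exact this.congr' ((h2 n).mono fun t ht => by linarith)
  have hQ : ∀ n : ℕ, ∑ j ∈ Finset.range n, cubeDiag (fun j : ℕ => 2 * (j : ℝ) + 1 + lam)
      (fun j : ℕ => j * (j + lam)) j =
        n * (n + lam) * (5 * n ^ 2 + 5 * n * lam + lam ^ 2 + 1) := by
    intro n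
    induction n with
    | zero => simp
    | succ n ih =>
      rw [Finset.sum_range_succ, ih, cubeDiag]
      rcases n with _ | n
      · push_cast; ring
      · rw [Nat.add_sub_cancel]; push_cast; ring
  -- `B` occurs in the equation for `A` only behind a factor `ε`, so its leading term suffices.
  have hA1 : ∀ n : ℕ, (fun t => A n t - (2 * n + 1 + lam - ε t *
      cubeDiag (fun j : ℕ => 2 * (j : ℝ) + 1 + lam) (fun j : ℕ => j * (j + lam)) n)) =O[l]
      fun t => ε t ^ 2 := fun n => by
    have := ((isBigO_refl ε l).mul (NearConst.cubeDiag hε hA0 hB0 n)).neg_left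
    refine this.congr' ((h1 n).mono fun t ht => ?_) (Eventually.of_forall fun t => by ring)
    linear_combination -ht
  refine (IsBigO.sum fun j (_ : j ∈ Finset.range n) => hA1 j).congr_left fun t => ?_
  rw [Finset.sum_apply, Finset.sum_sub_distrib, Finset.sum_sub_distrib, ← Finset.mul_sum, hsum, hQ]

/-- Solutions of the perturbed Hermite string equations, to second order. -/
lemma hermite_expansion (hε : ε =O[l] (1 : ℝ → ℝ)) (lam : ℝ)
    (hA : ∀ n, A n =O[l] (1 : ℝ → ℝ)) (hB : ∀ n, B n =O[l] (1 : ℝ → ℝ))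
    (h1 : ∀ n, ∀ᶠ t in l, 2 * A n t + 3 * (B n t + B (n + 1) t) +
      ε t * (3 * A n t ^ 2 + ε t * A n t ^ 3 + 2 * A n t * (B n t + B (n + 1) t)
        + A (n - 1) t * B n t + A (n + 1) t * B (n + 1) t) = 2 * n + 1 + lam)
    (h2 : ∀ n, ∀ᶠ t in l, 2 * B n t + ε t * (B n t * (3 * (A n t + A (n - 1) t)
        + ε t * (A n t ^ 2 + A n t * A (n - 1) t + A (n - 1) t ^ 2)
        + (B (n + 1) t + B n t + B (n - 1) t))) = n + ε t * ∑ j ∈ Finset.range n, A j t)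
    (n : ℕ) :
    (fun t => ∑ j ∈ Finset.range n, A j t - (n * (2 * lam - n) / 4 -
      ε t * (n * (4 * n ^ 2 - 24 * n * lam + 12 * lam ^ 2 + 1) / 32))) =O[l]
      fun t => ε t ^ 2 := by
  have bε : ∀ {f : ℝ → ℝ}, f =O[l] (1 : ℝ → ℝ) → (fun t => ε t * f t) =O[l] (1 : ℝ → ℝ) :=
    fun hf => isBigO_one_mul hε hf
  have hS : ∀ n, (fun t => ∑ j ∈ Finset.range n, A j t) =O[l] (1 : ℝ → ℝ) :=
    fun n => (IsBigO.sum (s := Finset.range n) fun j _ => hA j).congr_left fun t => by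
      rw [Finset.sum_apply]
  have hG : ∀ n, (fun t => 3 * A n t ^ 2 + ε t * A n t ^ 3 + 2 * A n t * (B n t + B (n + 1) t)
        + A (n - 1) t * B n t + A (n + 1) t * B (n + 1) t) =O[l] (1 : ℝ → ℝ) := fun n =>
    (((((isBigO_one_pow (hA n) 2).const_mul_left 3).add (bε (isBigO_one_pow (hA n) 3))).add
      (isBigO_one_mul ((hA n).const_mul_left 2) ((hB n).add (hB (n + 1))))).add
      (isBigO_one_mul (hA _) (hB _))).add (isBigO_one_mul (hA _) (hB _))
  have hH : ∀ n, (fun t => B n t * (3 * (A n t + A (n - 1) t)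
        + ε t * (A n t ^ 2 + A n t * A (n - 1) t + A (n - 1) t ^ 2)
        + (B (n + 1) t + B n t + B (n - 1) t))) =O[l] (1 : ℝ → ℝ) := fun n =>
    isBigO_one_mul (hB n) (((((hA n).add (hA _)).const_mul_left 3).add
      (bε (((isBigO_one_pow (hA n) 2).add (isBigO_one_mul (hA n) (hA _))).add
        (isBigO_one_pow (hA _) 2)))).add (((hB _).add (hB n)).add (hB _)))
  -- Here `B` occurs in the equation for `A` without a factor `ε`, so each order must be found for
  -- `B` before `A`.
  have hB0 : ∀ n : ℕ, NearConst l ε (B n) (n / 2) := fun n => by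
    have := (((nearConst_const (l := l) (ε := ε) (n : ℝ)).add (nearConst_eps_mul (hS n))).sub
      (nearConst_eps_mul (hH n))).const_mul (1 / 2)
    rw [sub_zero, add_zero, one_div_mul_eq_div] at this
    exact this.congr' ((h2 n).mono fun t ht => by linear_combination (-1 / 2) * ht)
  set a : ℕ → ℝ := fun n => (2 * lam - 2 * n - 1) / 4 with ha
  have hA0 : ∀ n : ℕ, NearConst l ε (A n) (a n) := fun n => by
    have := (((nearConst_const (l := l) (ε := ε) (2 * n + 1 + lam)).sub
      (((hB0 n).add (hB0 (n + 1))).const_mul 3)).sub (nearConst_eps_mul (hG n))).const_mul (1 / 2)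
    have e : (1 / 2 : ℝ) * (2 * n + 1 + lam - 3 * (n / 2 + (n + 1 : ℕ) / 2) - 0) =
        a n := by rw [ha]; push_cast; ring
    rw [e] at this
    exact this.congr' ((h1 n).mono fun t ht => by linear_combination (-1 / 2) * ht)
  have hsum : ∀ n : ℕ, ∑ j ∈ Finset.range n, a j = n * (2 * lam - n) / 4 := by
    intro n
    induction n with
    | zero => simp
    | succ n ih => rw [Finset.sum_range_succ, ih, ha]; push_cast; ring
  have hHn : ∀ n : ℕ, NearConst l ε (fun t => B n t * (3 * (A n t + A (n - 1) t)
        + ε t * (A n t ^ 2 + A n t * A (n - 1) t + A (n - 1) t ^ 2)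
        + (B (n + 1) t + B n t + B (n - 1) t)))
      (n / 2 * (3 * (a n + a (n - 1)) + 0 + (((n + 1 : ℕ) : ℝ) / 2 + n / 2 + (n - 1 : ℕ) / 2))) :=
    fun n => (hB0 n).mul hε (((((hA0 n).add (hA0 _)).const_mul 3).add
      (nearConst_eps_mul (((isBigO_one_pow (hA n) 2).add (isBigO_one_mul (hA n) (hA _))).add
        (isBigO_one_pow (hA _) 2)))).add (((hB0 _).add (hB0 n)).add (hB0 _)))
  -- The leading terms of `A` and `B` inserted behind `ε` give the first correction of `B`.
  have hB1 : ∀ n : ℕ, (fun t => B n t - (n / 2 + ε t * (n * (n - 2 * lam) / 4))) =O[l]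
      fun t => ε t ^ 2 := fun n => by
    have h := (((isBigO_refl ε l).mul
      ((NearConst.sum (Finset.range n) fun j _ => hA0 j).sub (hHn n))).const_mul_left (1 / 2))
    refine h.congr' ((h2 n).mono fun t ht => ?_) (Eventually.of_forall fun t => by ring)
    simp only [hsum]
    rcases n with _ | n
    · simp at ht ⊢
      linear_combination (-1 / 2) * ht
    · simp only [Nat.add_sub_cancel, ha] at ht ⊢
      push_cast at ht ⊢
      linear_combination (-1 / 2) * ht
  have hGn : ∀ n : ℕ, NearConst l ε (fun t => 3 * A n t ^ 2 + ε t * A n t ^ 3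
        + 2 * A n t * (B n t + B (n + 1) t) + A (n - 1) t * B n t + A (n + 1) t * B (n + 1) t)
      (3 * a n ^ 2 + 0 + 2 * a n * (n / 2 + ((n + 1 : ℕ) : ℝ) / 2) + a (n - 1) * (n / 2)
        + a (n + 1) * (((n + 1 : ℕ) : ℝ) / 2)) := fun n =>
    ((((((hA0 n).pow hε 2).const_mul 3).add (nearConst_eps_mul (isBigO_one_pow (hA n) 3))).add
      (((hA0 n).const_mul 2).mul hε ((hB0 n).add (hB0 (n + 1))))).add
      ((hA0 _).mul hε (hB0 _))).add ((hA0 _).mul hε (hB0 _))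
  set q : ℕ → ℝ := fun n => (3 * (n * (n - 2 * lam) / 4 + (n + 1) * (n + 1 - 2 * lam) / 4)
    + (3 * a n ^ 2 + 0 + 2 * a n * (n / 2 + ((n + 1 : ℕ) : ℝ) / 2) + a (n - 1) * (n / 2)
        + a (n + 1) * (((n + 1 : ℕ) : ℝ) / 2))) / 2 with hq
  have hqsum : ∀ n : ℕ, ∑ j ∈ Finset.range n, q j =
      n * (4 * n ^ 2 - 24 * n * lam + 12 * lam ^ 2 + 1) / 32 := by
    intro n
    induction n with
    | zero => simp
    | succ n ih =>
      rw [Finset.sum_range_succ, ih, hq, ha]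
      rcases n with _ | n
      · push_cast; ring
      · simp only [Nat.add_sub_cancel]; push_cast; ring
  have hA1 : ∀ n : ℕ, (fun t => A n t - (a n - ε t * q n)) =O[l] fun t => ε t ^ 2 := fun n => by
    have h := ((((hB1 n).add (hB1 (n + 1))).const_mul_left 3).add
      (((isBigO_refl ε l).mul (hGn n)).congr_right fun t => (pow_two _).symm)).const_mul_left
        (-1 / 2)
    refine h.congr' ((h1 n).mono fun t ht => ?_) EventuallyEq.rfl
    simp only [hq, ha] at ht ⊢
    push_cast at ht ⊢
    linear_combination (-1 / 2) * ht
  refine (IsBigO.sum fun j (_ : j ∈ Finset.range n) => hA1 j).congr_left fun t => ?_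
  rw [Finset.sum_apply, Finset.sum_sub_distrib, Finset.sum_sub_distrib, ← Finset.mul_sum, hsum, hqsum]

end Expansion

/-! ### The limit `t → -∞`. -/

lemma cubeDiag_scale (a b : ℕ → ℝ) (c : ℝ) (n : ℕ) :
    cubeDiag (fun n => c * a n) (fun n => c ^ 2 * b n) n = c ^ 3 * cubeDiag a b n := by
  unfold cubeDiag; ring

lemma cubeOff_scale (a b : ℕ → ℝ) (c : ℝ) (n : ℕ) :
    cubeOff (fun n => c * a n) (fun n => c ^ 2 * b n) n = c ^ 4 * cubeOff a b n := by
  unfold cubeOff; ring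

section

variable {lam : ℝ} (hlam : -1 < lam) (t : ℝ)

include hlam in
lemma cubeDiag_airy (n : ℕ) : cubeDiag (airyAlpha lam t) (airyBeta lam t) n =
    t * airyAlpha lam t n + (2 * n + 1 + lam) := airyAlpha_string hlam t n

include hlam in
lemma cubeOff_airy (n : ℕ) : cubeOff (airyAlpha lam t) (airyBeta lam t) n =
    t * airyBeta lam t n + ∑ j ∈ Finset.range n, airyAlpha lam t j := by
  rw [← airyBeta_string hlam t n, cubeOff]; ring

include hlam in
lemma cubeDiag_airy_nonneg (n : ℕ) : 0 ≤ cubeDiag (airyAlpha lam t) (airyBeta lam t) n := by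
  have ha := fun n => (airyAlpha_pos hlam t n).le
  have hb := fun n => airyBeta_nonneg hlam t n
  unfold cubeDiag
  have h1 := mul_nonneg (ha n) (add_nonneg (hb n) (hb (n + 1)))
  have h2 := mul_nonneg (ha (n - 1)) (hb n)
  have h3 := mul_nonneg (ha (n + 1)) (hb (n + 1))
  have h4 := pow_nonneg (ha n) 3
  nlinarith

include hlam in
lemma cubeOff_airy_nonneg (n : ℕ) : 0 ≤ cubeOff (airyAlpha lam t) (airyBeta lam t) n := by
  have ha := fun n => (airyAlpha_pos hlam t n).le
  have hb := fun n => airyBeta_nonneg hlam t n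
  unfold cubeOff
  have h1 := mul_nonneg (ha n) (ha (n - 1))
  have := hb (n + 1)
  have := hb (n - 1)
  have := hb n
  have := sq_nonneg (airyAlpha lam t n)
  have := sq_nonneg (airyAlpha lam t (n - 1))
  exact mul_nonneg (hb n) (by linarith)

end

/-- The functions `A` and `B` are the recurrence coefficients after the dilation `x ↦ x / |t|`,
which turns the weight into a Laguerre weight times `exp (-ε x^3 / 3)`. Undoing it multiplies the
`O(ε^2)` error by `1/t`, whence `t^(-7)`. -/
lemma airySubleading_atBot {lam : ℝ} (hlam : -1 < lam) (n : ℕ) :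
    (fun t : ℝ => airySubleading lam n t -
        ((n : ℝ) * (n + lam) / t +
          (n : ℝ) * (n + lam) * (5 * (n : ℝ) ^ 2 + 5 * n * lam + lam ^ 2 + 1) / t ^ 4))
      =O[atBot] fun t : ℝ => 1 / t ^ 7 := by
  have hneg : ∀ᶠ t : ℝ in atBot, t < 0 := eventually_lt_atBot 0
  set ε : ℝ → ℝ := fun t => -(t ^ 3)⁻¹ with hεd
  set A : ℕ → ℝ → ℝ := fun n t => -t * airyAlpha lam t n with hAd
  set B : ℕ → ℝ → ℝ := fun n t => (-t) ^ 2 * airyBeta lam t n with hBd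
  -- The string equation expresses `2n + 1 + lam - A_n` as a diagonal entry of the cubed recurrence
  -- matrix, which is nonnegative.
  have hAle : ∀ n t, t < 0 → A n t ≤ 2 * n + 1 + lam := fun n t _ => by
    have h1 := cubeDiag_airy hlam t n
    have h2 := cubeDiag_airy_nonneg hlam t n
    simp only [hAd]; linarith
  have hA0 : ∀ n t, t < 0 → 0 ≤ A n t := fun n t ht =>
    mul_nonneg (by linarith) (airyAlpha_pos hlam t n).le
  have hA : ∀ n, A n =O[atBot] (1 : ℝ → ℝ) := fun n => by
    refine IsBigO.of_bound (2 * n + 1 + lam) (hneg.mono fun t ht => ?_)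
    rw [Real.norm_of_nonneg (hA0 n t ht)]
    simpa using hAle n t ht
  have hB : ∀ n, B n =O[atBot] (1 : ℝ → ℝ) := fun n => by
    have hS : (fun t => ∑ j ∈ Finset.range n, A j t) =O[atBot] (1 : ℝ → ℝ) :=
      (IsBigO.sum (s := Finset.range n) fun j _ => hA j).congr_left fun t => by
        rw [Finset.sum_apply]
    refine IsBigO.trans (IsBigO.of_bound 1 (hneg.mono fun t ht => ?_)) hS
    have h1 := cubeOff_airy hlam t n
    have h2 := cubeOff_airy_nonneg hlam t n
    have h3 : B n t ≤ ∑ j ∈ Finset.range n, A j t := by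
      simp only [hAd, hBd, ← Finset.mul_sum]
      nlinarith
    have h4 : 0 ≤ B n t := mul_nonneg (sq_nonneg _) (airyBeta_nonneg hlam t n)
    rw [Real.norm_of_nonneg h4, Real.norm_of_nonneg (h4.trans h3), one_mul]
    exact h3
  have hε : ε =O[atBot] (1 : ℝ → ℝ) := by
    refine IsBigO.of_bound 1 ((eventually_le_atBot (-1 : ℝ)).mono fun t ht => ?_)
    have : 1 ≤ |t| ^ 3 := one_le_pow₀ (by rw [abs_of_nonpos (by linarith)]; linarith)
    simpa [hεd] using inv_le_one_of_one_le₀ this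
  have h1 : ∀ n, ∀ᶠ t in atBot, A n t + ε t * cubeDiag (A · t) (B · t) n = 2 * n + 1 + lam :=
    fun n => hneg.mono fun t ht => by
      have h := cubeDiag_airy hlam t n
      have ht' := ht.ne
      simp only [hAd, hBd, hεd, cubeDiag_scale, h]
      field_simp
      ring
  have h2 : ∀ n, ∀ᶠ t in atBot, B n t + ε t * cubeOff (A · t) (B · t) n =
      ∑ j ∈ Finset.range n, A j t := fun n => hneg.mono fun t ht => by
    have h := cubeOff_airy hlam t n
    have ht' := ht.ne
    simp only [hAd, hBd, hεd, cubeOff_scale, h, ← Finset.mul_sum]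
    field_simp
    ring
  have h := (isBigO_refl (fun t : ℝ => 1 / t) atBot).mul
    (laguerre_expansion hε lam hA hB h1 h2 n)
  refine h.congr' (hneg.mono fun t ht => ?_) (hneg.mono fun t ht => ?_)
  · have ht' := ht.ne
    simp only [airySubleading_eq_neg_sum hlam, hAd, ← Finset.mul_sum, hεd]
    field_simp
    ring
  · have ht' := ht.ne
    simp only [hεd]
    field_simp

/-! ### Concentration of the weight near `s = √t`. -/

section

variable {lam : ℝ} (hlam : -1 < lam) (s : ℝ)

/-- At `t = s^2` one has `x^3 - t x = x (x + s)(x - s)`, so a power of `x - s` is a natural test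
polynomial. -/
lemma airyFunctional_by_parts_shift (m : ℕ) :
    airyFunctional hlam (s ^ 2) (C (m : ℝ) * (X * (X - C s) ^ (m - 1)) +
      C (lam + 1) * (X - C s) ^ m - X * (X + C s) * (X - C s) ^ (m + 1)) = 0 := by
  have h := airyFunctional_by_parts hlam (s ^ 2) ((X - C s) ^ m)
  rw [← h]
  congr 1
  rw [derivative_X_sub_C_pow, C_pow, pow_succ _ m]
  simp only [map_natCast]
  ring

/-- In the identity for the odd power `2k + 1`, the terms `x^2 (x - s)^(2k+2)` and `(lam + 1) s (x -
s)^(2k)` have a favourable sign and are dropped. The factor `x` on both sides lets the bound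
iterate. -/
lemma airyFunctional_X_mul_shift_succ_le (hs : 0 < s) (k : ℕ) :
    s * airyFunctional hlam (s ^ 2) (X * (X - C s) ^ (2 * (k + 1))) ≤
      (2 * k + 2 + lam) * airyFunctional hlam (s ^ 2) (X * (X - C s) ^ (2 * k)) := by
  have h := airyFunctional_by_parts_shift hlam s (2 * k + 1)
  rw [Nat.add_sub_cancel] at h
  rw [← airyFunctional_C_mul, ← airyFunctional_C_mul, ← add_zero (airyFunctional _ _ (C s * _)),
    ← h, ← map_add]
  refine airyFunctional_mono hlam _ fun x hx => ?_
  simp only [eval_add, eval_sub, eval_mul, eval_pow, eval_X, eval_C]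
  have e : (x - s) ^ (2 * (k + 1)) = (x - s) ^ (2 * k) * (x - s) ^ 2 := by ring
  have e1 : (x - s) ^ (2 * k + 1) = (x - s) ^ (2 * k) * (x - s) := by ring
  have e2 : (x - s) ^ (2 * k + 1 + 1) = (x - s) ^ (2 * k) * (x - s) ^ 2 := by ring
  rw [e, e1, e2]
  push_cast
  have h0 : 0 ≤ (x - s) ^ (2 * k) := (even_two_mul k).pow_nonneg _
  have h1 : 0 ≤ (lam + 1) * s * (x - s) ^ (2 * k) :=
    mul_nonneg (mul_nonneg (by linarith) hs.le) h0
  have h2 : 0 ≤ x ^ 2 * ((x - s) ^ (2 * k) * (x - s) ^ 2) := by positivity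
  linarith

lemma airyFunctional_X_mul_shift_nonneg (k : ℕ) :
    0 ≤ airyFunctional hlam (s ^ 2) (X * (X - C s) ^ (2 * k)) :=
  airyFunctional_nonneg hlam _ fun x hx => by
    simp only [eval_sub, eval_mul, eval_pow, eval_X, eval_C]
    exact mul_nonneg hx.le ((even_two_mul k).pow_nonneg _)

lemma airyFunctional_shift_nonneg (k : ℕ) :
    0 ≤ airyFunctional hlam (s ^ 2) ((X - C s) ^ (2 * k)) :=
  airyFunctional_nonneg hlam _ fun x _ => by
    simp only [eval_sub, eval_pow, eval_X, eval_C]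
    exact (even_two_mul k).pow_nonneg _

lemma exists_airyFunctional_X_mul_shift_le (k : ℕ) : ∃ c : ℝ, ∀ s : ℝ, 0 < s →
    s ^ k * airyFunctional hlam (s ^ 2) (X * (X - C s) ^ (2 * k)) ≤
      c * airyFunctional hlam (s ^ 2) X := by
  induction k with
  | zero => exact ⟨1, fun s _ => by simp⟩
  | succ k ih =>
    obtain ⟨c, hc⟩ := ih
    refine ⟨(2 * k + 2 + lam) * c, fun s hs => ?_⟩
    have h1 := mul_le_mul_of_nonneg_left (airyFunctional_X_mul_shift_succ_le hlam s hs k)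
      (pow_pos hs k).le
    have h2 := mul_le_mul_of_nonneg_left (hc s hs)
      (by have : (0 : ℝ) ≤ k := k.cast_nonneg
          linarith : (0 : ℝ) ≤ 2 * k + 2 + lam)
    calc _ = s ^ k * (s * airyFunctional hlam (s ^ 2) (X * (X - C s) ^ (2 * (k + 1)))) := by ring
      _ ≤ _ := h1
      _ = (2 * k + 2 + lam) *
          (s ^ k * airyFunctional hlam (s ^ 2) (X * (X - C s) ^ (2 * k))) := by ring
      _ ≤ _ := h2
      _ = _ := by ring

/-- This removes the factor `x`, using `lam + 1 > 0`. With `u = x - s`, the odd powers in the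
identity are absorbed by `2u^3 ≤ u^4 + u^2` and `-2u ≤ u^2 + 1`. -/
lemma airyFunctional_shift_succ_le (hs : 0 < s) (k : ℕ) :
    (lam + 1) * airyFunctional hlam (s ^ 2) ((X - C s) ^ (2 * (k + 1))) ≤
      (s + 1) * airyFunctional hlam (s ^ 2) (X * (X - C s) ^ (2 * (k + 2))) +
      (s + (k + 1)) * airyFunctional hlam (s ^ 2) (X * (X - C s) ^ (2 * (k + 1))) +
      (k + 1) * airyFunctional hlam (s ^ 2) (X * (X - C s) ^ (2 * k)) := by
  have h := airyFunctional_by_parts_shift hlam s (2 * (k + 1))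
  rw [show 2 * (k + 1) - 1 = 2 * k + 1 by omega] at h
  simp only [← airyFunctional_C_mul, ← map_add]
  rw [← sub_zero (airyFunctional _ _ (C (lam + 1) * _)), ← h, ← map_sub]
  refine airyFunctional_mono hlam _ fun x hx => ?_
  simp only [eval_add, eval_sub, eval_mul, eval_pow, eval_X, eval_C]
  set u := x - s with hu
  have hxu : x + s = u + 2 * s := by rw [hu]; ring
  rw [hxu]
  have h0 : 0 ≤ x * u ^ (2 * k) := mul_nonneg hx.le ((even_two_mul k).pow_nonneg _)
  have hk : (0 : ℝ) ≤ k := k.cast_nonneg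
  have e : u ^ (2 * (k + 2)) = u ^ (2 * k) * u ^ 4 := by ring
  have e0 : u ^ (2 * (k + 1)) = u ^ (2 * k) * u ^ 2 := by ring
  have e1 : u ^ (2 * k + 1) = u ^ (2 * k) * u := by ring
  have e2 : u ^ (2 * (k + 1) + 1) = u ^ (2 * k) * u ^ 3 := by ring
  rw [e, e0, e1, e2]
  push_cast
  have h1 : 0 ≤ (k + 1) * (x * u ^ (2 * k) * (1 + u) ^ 2) := by positivity
  have h2 : 0 ≤ s * (x * u ^ (2 * k) * (u * (1 - u)) ^ 2) := by positivity
  linarith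

/-- Pointwise, `s ≤ 2x + (4/s)(x - s)^2`: the first term suffices for `x ≥ s/2`, the second for `x ≤
s/2`. -/
lemma airyFunctional_shift_le (hs : 0 < s) (k : ℕ) :
    s * airyFunctional hlam (s ^ 2) ((X - C s) ^ (2 * k)) ≤
      2 * airyFunctional hlam (s ^ 2) (X * (X - C s) ^ (2 * k)) +
      (4 / s) * airyFunctional hlam (s ^ 2) ((X - C s) ^ (2 * (k + 1))) := by
  simp only [← airyFunctional_C_mul, ← map_add]
  refine airyFunctional_mono hlam _ fun x hx => ?_
  simp only [eval_add, eval_sub, eval_mul, eval_pow, eval_X, eval_C]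
  have e : (x - s) ^ (2 * (k + 1)) = (x - s) ^ (2 * k) * (x - s) ^ 2 := by ring
  rw [e]
  have h0 : 0 ≤ (x - s) ^ (2 * k) := (even_two_mul k).pow_nonneg _
  have h1 : s ≤ 2 * x + 4 / s * (x - s) ^ 2 := by
    have e' : 2 * x + 4 / s * (x - s) ^ 2 = (2 * x * s + 4 * (x - s) ^ 2) / s := by
      field_simp
    rw [e', le_div_iff₀ hs]
    nlinarith [sq_nonneg (4 * x - 3 * s), sq_nonneg s]
  nlinarith [mul_le_mul_of_nonneg_right h1 h0]

/-- The even moments about `√t` are concentrated on the Gaussian scale. -/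
lemma exists_airyFunctional_shift_le (k : ℕ) : ∃ D : ℝ, 0 ≤ D ∧ ∀ s : ℝ, 1 ≤ s →
    s ^ (k + 1) * airyFunctional hlam (s ^ 2) ((X - C s) ^ (2 * k)) ≤
      D * airyFunctional hlam (s ^ 2) X := by
  obtain ⟨c0, h0⟩ := exists_airyFunctional_X_mul_shift_le hlam k
  obtain ⟨c1, h1⟩ := exists_airyFunctional_X_mul_shift_le hlam (k + 1)
  obtain ⟨c2, h2⟩ := exists_airyFunctional_X_mul_shift_le hlam (k + 2)
  have hl : 0 < lam + 1 := by linarith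
  -- The crude bound `s^k M1 ≤ const * Z` is enough, because `M1` enters the estimate of `s M0` with
  -- coefficient `4/s ≤ 4`.
  set D := 2 * c0 + 4 * ((2 * c2 + (k + 2) * c1 + (k + 1) * c0) / (lam + 1)) with hD
  refine ⟨max D 0, le_max_right _ _, fun s hs => ?_⟩
  have hs0 : 0 < s := by linarith
  have hk : (0 : ℝ) ≤ k := k.cast_nonneg
  specialize h0 s hs0
  specialize h1 s hs0
  specialize h2 s hs0
  have g1 := airyFunctional_shift_succ_le hlam s hs0 k
  have g2 := airyFunctional_shift_le hlam s hs0 k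
  have n1 := airyFunctional_X_mul_shift_nonneg hlam s (k + 1)
  have n2 := airyFunctional_X_mul_shift_nonneg hlam s (k + 2)
  have m1 := airyFunctional_shift_nonneg hlam s (k + 1)
  have nX : 0 ≤ airyFunctional hlam (s ^ 2) X := by
    simpa using airyFunctional_X_mul_shift_nonneg hlam s 0
  set N0 := airyFunctional hlam (s ^ 2) (X * (X - C s) ^ (2 * k))
  set N1 := airyFunctional hlam (s ^ 2) (X * (X - C s) ^ (2 * (k + 1)))
  set N2 := airyFunctional hlam (s ^ 2) (X * (X - C s) ^ (2 * (k + 2)))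
  set M0 := airyFunctional hlam (s ^ 2) ((X - C s) ^ (2 * k))
  set M1 := airyFunctional hlam (s ^ 2) ((X - C s) ^ (2 * (k + 1)))
  set Z := airyFunctional hlam (s ^ 2) X
  have p : 0 < s ^ k := pow_pos hs0 k
  have a2 : s ^ k * ((s + 1) * N2) ≤ 2 * (c2 * Z) := by
    have : s ^ k * ((s + 1) * N2) ≤ 2 * (s ^ (k + 2) * N2) := by
      have : 0 ≤ s ^ k * N2 := mul_nonneg p.le n2
      rw [pow_add]
      nlinarith [mul_nonneg this (by nlinarith : (0 : ℝ) ≤ 2 * s ^ 2 - (s + 1))]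
    linarith
  have a1 : s ^ k * ((s + (k + 1)) * N1) ≤ (k + 2) * (c1 * Z) := by
    have : s ^ k * ((s + (k + 1)) * N1) ≤ (k + 2) * (s ^ (k + 1) * N1) := by
      have : 0 ≤ s ^ k * N1 := mul_nonneg p.le n1
      rw [pow_succ]
      nlinarith [mul_nonneg this (by nlinarith : (0 : ℝ) ≤ (k + 2) * s - (s + (k + 1)))]
    have := mul_le_mul_of_nonneg_left h1 (by linarith : (0 : ℝ) ≤ k + 2)
    linarith
  have a0 : s ^ k * ((k + 1) * N0) ≤ (k + 1) * (c0 * Z) := by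
    have := mul_le_mul_of_nonneg_left h0 (by linarith : (0 : ℝ) ≤ k + 1)
    linarith
  have b : s ^ k * M1 ≤ (2 * c2 + (k + 2) * c1 + (k + 1) * c0) / (lam + 1) * Z := by
    rw [div_mul_eq_mul_div, le_div_iff₀ hl]
    have := mul_le_mul_of_nonneg_left g1 p.le
    linarith
  have d : 4 / s * M1 ≤ 4 * M1 :=
    mul_le_mul_of_nonneg_right (div_le_self (by norm_num) hs) m1
  have f : s ^ (k + 1) * M0 ≤ D * Z := by
    have := mul_le_mul_of_nonneg_left (g2.trans (add_le_add_right d _)) p.le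
    rw [pow_succ, hD]
    linarith
  exact f.trans (mul_le_mul_of_nonneg_right (le_max_left _ _) nX)

/-- The orthogonal polynomial minimizes the norm among monic polynomials of its degree. -/
lemma airyNorm_le_of_monic (t : ℝ) {q : ℝ[X]} (hq : q.Monic) {n : ℕ} (hn : q.natDegree = n) :
    airyNorm lam t n ≤ airyFunctional hlam t (q * q) := by
  have hqd : q.degree = n := by rw [degree_eq_natDegree hq.ne_zero, hn]
  have h1 : airyFunctional hlam t (q * airyPoly lam t n) = airyNorm lam t n := by
    rw [airyFunctional_mul_airyPoly hlam t hqd.le, ← hn, hq.coeff_natDegree, one_mul]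
  have h2 := airyFunctional_airyPoly_sq hlam t n
  have h3 : 0 ≤ airyFunctional hlam t ((q - airyPoly lam t n) * (q - airyPoly lam t n)) :=
    airyFunctional_nonneg hlam t fun x _ => by
      rw [eval_mul]; exact mul_self_nonneg _
  have e : (q - airyPoly lam t n) * (q - airyPoly lam t n) =
      q * q - C 2 * (q * airyPoly lam t n) + airyPoly lam t n * airyPoly lam t n := by
    rw [map_ofNat]; ring
  rw [e, map_add, map_sub, airyFunctional_C_mul, h1, h2] at h3
  linarith

lemma airyPoly_zero (t : ℝ) : airyPoly lam t 0 = 1 := by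
  rw [airyPoly]; simp

lemma airyFunctional_X (t : ℝ) :
    airyFunctional hlam t X = airyAlpha lam t 0 * airyNorm lam t 0 := by
  rw [← airyFunctional_X_mul_sq hlam, airyPoly_zero, mul_one, mul_one]

include hlam in
-- The trial polynomial `(X - s)^n` in the minimum property turns the moment bound into a norm
-- bound.
lemma exists_airyNorm_le (n : ℕ) : ∃ D : ℝ, 0 ≤ D ∧ ∀ s : ℝ, 1 ≤ s →
    s ^ (n + 1) * airyNorm lam (s ^ 2) n ≤
      D * (airyAlpha lam (s ^ 2) 0 * airyNorm lam (s ^ 2) 0) := by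
  obtain ⟨D, hD0, hD⟩ := exists_airyFunctional_shift_le hlam n
  refine ⟨D, hD0, fun s hs => ?_⟩
  rw [← airyFunctional_X hlam]
  refine le_trans ?_ (hD s hs)
  refine mul_le_mul_of_nonneg_left ?_ (by positivity)
  have := airyNorm_le_of_monic hlam (s ^ 2) ((monic_X_sub_C s).pow n) (n := n) (by simp)
  rwa [← pow_add, ← two_mul] at this

/-- Pythagoras for the orthogonal decomposition `X - s = P_1 + (α_0 - s) P_0`. -/
lemma airyAlpha_zero_sub_sq_le (t : ℝ) :
    (airyAlpha lam t 0 - s) ^ 2 * airyNorm lam t 0 ≤ airyFunctional hlam t ((X - C s) ^ 2) := by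
  have h := X_mul_airyPoly hlam t 0
  rw [airyPoly_zero, airyBeta_zero] at h
  have e : (X - C s) ^ 2 = airyPoly lam t 1 * airyPoly lam t 1 +
      C (2 * (airyAlpha lam t 0 - s)) * (airyPoly lam t 0 * airyPoly lam t 1) +
      C ((airyAlpha lam t 0 - s) ^ 2) * (airyPoly lam t 0 * airyPoly lam t 0) := by
    have : X - C s = airyPoly lam t 1 + C (airyAlpha lam t 0 - s) := by
      rw [C_sub]
      simp only [mul_one, map_zero, Nat.zero_add, add_zero] at h
      linear_combination h
    rw [this, airyPoly_zero, C_mul, C_pow, map_ofNat]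
    ring
  rw [e, map_add, map_add, airyFunctional_C_mul, airyFunctional_C_mul,
    airyFunctional_airyPoly_mul hlam t zero_ne_one, airyFunctional_airyPoly_sq,
    airyFunctional_airyPoly_sq]
  have := airyNorm_pos hlam t 1
  linarith

end

/-! ### A priori bounds on the recurrence coefficients as `t → +∞`. -/

section

variable {lam : ℝ} (hlam : -1 < lam)

include hlam

/-- Dropping the nonnegative `β` terms leaves `α (α^2 - s^2) ≤ 2n + 1 + lam`, which is impossible
for `α > 2s` and large `s`. -/
lemma eventually_airyAlpha_le (n : ℕ) :
    ∀ᶠ s : ℝ in atTop, airyAlpha lam (s ^ 2) n ≤ 2 * s := by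
  filter_upwards [eventually_ge_atTop 1, eventually_ge_atTop (2 * n + 1 + lam)] with s h1 h2
  by_contra! h
  have e := cubeDiag_airy hlam (s ^ 2) n
  have ha := fun n => (airyAlpha_pos hlam (s ^ 2) n).le
  have hb := fun n => airyBeta_nonneg hlam (s ^ 2) n
  unfold cubeDiag at e
  have g1 := mul_nonneg (ha n) (add_nonneg (hb n) (hb (n + 1)))
  have g2 := mul_nonneg (ha (n - 1)) (hb n)
  have g3 := mul_nonneg (ha (n + 1)) (hb (n + 1))
  set a := airyAlpha lam (s ^ 2) n
  have g4 : s ^ 2 < a ^ 2 - s ^ 2 := by nlinarith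
  have g5 : 2 * s * s ^ 2 < a * (a ^ 2 - s ^ 2) := by
    have : (0 : ℝ) < s ^ 2 := by positivity
    nlinarith
  have g6 : s ≤ s * s ^ 2 := by nlinarith
  nlinarith

lemma eventually_airyAlpha_sum_le (n : ℕ) :
    ∀ᶠ s : ℝ in atTop, ∑ j ∈ Finset.range n, airyAlpha lam (s ^ 2) j ≤ n * (2 * s) := by
  have h : ∀ᶠ s : ℝ in atTop, ∀ j ∈ Finset.range n, airyAlpha lam (s ^ 2) j ≤ 2 * s :=
    (Finset.eventually_all _).2 fun j _ => eventually_airyAlpha_le hlam j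
  filter_upwards [h] with s hs
  simpa using Finset.sum_le_card_nsmul _ _ _ hs

lemma eventually_airyBeta_le_sq (n : ℕ) :
    ∀ᶠ s : ℝ in atTop, airyBeta lam (s ^ 2) n ≤ 2 * s ^ 2 := by
  filter_upwards [eventually_airyAlpha_sum_le hlam n, eventually_ge_atTop 1,
    eventually_ge_atTop (n : ℝ)] with s h1 h2 h3
  by_contra! h
  have e := airyBeta_string hlam (s ^ 2) n
  have ha := fun n => (airyAlpha_pos hlam (s ^ 2) n).le
  have hb := fun n => airyBeta_nonneg hlam (s ^ 2) n
  have g1 := mul_nonneg (ha n) (ha (n - 1))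
  have g2 := hb (n + 1)
  have g3 := hb (n - 1)
  have g4 := sq_nonneg (airyAlpha lam (s ^ 2) n)
  have g5 := sq_nonneg (airyAlpha lam (s ^ 2) (n - 1))
  have hs : 1 ≤ s ^ 2 := one_le_pow₀ h2
  have g6 : airyBeta lam (s ^ 2) n * s ^ 2 ≤ n * (2 * s) := by
    rw [← e] at h1
    exact (mul_le_mul_of_nonneg_left (by linarith) (hb n)).trans h1
  have g7 : (n : ℝ) * (2 * s) ≤ 2 * s ^ 2 := by nlinarith
  nlinarith

/-- Otherwise the second moment about `s` would be at least `s^2/4` times the mass, against a bound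
of order `1/s`. -/
lemma eventually_airyAlpha_zero_ge :
    ∀ᶠ s : ℝ in atTop, s / 2 ≤ airyAlpha lam (s ^ 2) 0 := by
  obtain ⟨D, hD0, hD⟩ := exists_airyFunctional_shift_le hlam 1
  filter_upwards [eventually_airyAlpha_le hlam 0, eventually_ge_atTop 1,
    eventually_gt_atTop (8 * D)] with s h1 h2 h3
  by_contra! h
  have g := airyAlpha_zero_sub_sq_le hlam s (s ^ 2)
  have hN := airyNorm_pos hlam (s ^ 2) 0
  have hd := hD s h2
  rw [airyFunctional_X, mul_one, one_add_one_eq_two] at hd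
  have g1 : s ^ 2 * ((airyAlpha lam (s ^ 2) 0 - s) ^ 2) ≤ D * airyAlpha lam (s ^ 2) 0 := by
    refine le_of_mul_le_mul_right ?_ hN
    have := mul_le_mul_of_nonneg_left g (by positivity : 0 ≤ s ^ 2)
    linarith
  have g2 : s ^ 2 / 4 ≤ (airyAlpha lam (s ^ 2) 0 - s) ^ 2 := by nlinarith
  have g3 : D * airyAlpha lam (s ^ 2) 0 ≤ D * (2 * s) := mul_le_mul_of_nonneg_left h1 hD0
  have g4 : s ^ 2 * (s ^ 2 / 4) ≤ D * (2 * s) := by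
    have := mul_le_mul_of_nonneg_left g2 (by positivity : 0 ≤ s ^ 2)
    linarith
  have g5 : s ^ 2 * s ^ 2 ≤ 8 * D * s := by linarith
  have g6 : s ^ 2 ≤ s ^ 2 * s ^ 2 := le_mul_of_one_le_left (by positivity) (one_le_pow₀ h2)
  nlinarith

lemma eventually_airyAlpha_sum_ge (n : ℕ) :
    ∀ᶠ s : ℝ in atTop, s / 2 ≤ ∑ j ∈ Finset.range (n + 1), airyAlpha lam (s ^ 2) j := by
  filter_upwards [eventually_airyAlpha_zero_ge hlam] with s hs
  exact hs.trans (Finset.single_le_sum (f := fun j => airyAlpha lam (s ^ 2) j)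
    (fun j _ => (airyAlpha_pos hlam (s ^ 2) j).le) (Finset.mem_range.2 n.succ_pos))

/-- In the off-diagonal string equation the bracket is at most `3 * 4s^2 + 3 * 2s^2 = 18 s^2`, while
the sum of the `α_j` is at least `s/2`; hence the constant `1/36`. -/
lemma eventually_airyBeta_ge (n : ℕ) :
    ∀ᶠ s : ℝ in atTop, 1 / 36 ≤ s * airyBeta lam (s ^ 2) (n + 1) := by
  filter_upwards [eventually_airyAlpha_sum_ge hlam n, eventually_airyAlpha_le hlam n,
    eventually_airyAlpha_le hlam (n + 1), eventually_airyBeta_le_sq hlam n,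
    eventually_airyBeta_le_sq hlam (n + 1), eventually_airyBeta_le_sq hlam (n + 2),
    eventually_ge_atTop 1] with s h1 h2 h3 h4 h5 h6 h7
  have e := airyBeta_string hlam (s ^ 2) (n + 1)
  rw [Nat.add_sub_cancel] at e
  have ha := fun n => (airyAlpha_pos hlam (s ^ 2) n).le
  rw [← e] at h1
  have g1 : airyAlpha lam (s ^ 2) (n + 1) ^ 2 ≤ (2 * s) ^ 2 := pow_le_pow_left₀ (ha _) h3 2
  have g2 : airyAlpha lam (s ^ 2) n ^ 2 ≤ (2 * s) ^ 2 := pow_le_pow_left₀ (ha _) h2 2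
  have g3 : airyAlpha lam (s ^ 2) (n + 1) * airyAlpha lam (s ^ 2) n ≤ (2 * s) * (2 * s) :=
    mul_le_mul h3 h2 (ha _) (by linarith)
  have g4 : s / 2 ≤ airyBeta lam (s ^ 2) (n + 1) * (18 * s ^ 2) := by
    refine h1.trans (mul_le_mul_of_nonneg_left ?_ (airyBeta_nonneg hlam _ _))
    have e2 : n + 1 + 1 = n + 2 := rfl
    rw [e2]
    nlinarith [sq_nonneg s]
  have hs : 0 < s := by linarith
  refine le_of_mul_le_mul_right ?_ (mul_pos hs (by norm_num : (0 : ℝ) < 18))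
  linarith

lemma eventually_airyNorm_ge (n : ℕ) : ∀ᶠ s : ℝ in atTop,
    (1 / 36) ^ n * airyNorm lam (s ^ 2) 0 ≤ s ^ n * airyNorm lam (s ^ 2) n := by
  induction n with
  | zero => simp
  | succ n ih =>
    filter_upwards [ih, eventually_airyBeta_ge hlam n, eventually_ge_atTop 1] with s h1 h2 h3
    rw [← airyBeta_succ_mul hlam]
    have hN : 0 ≤ s ^ n * airyNorm lam (s ^ 2) n :=
      mul_nonneg (by positivity) (airyNorm_pos hlam _ _).le
    calc _ = 1 / 36 * ((1 / 36) ^ n * airyNorm lam (s ^ 2) 0) := by ring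
      _ ≤ 1 / 36 * (s ^ n * airyNorm lam (s ^ 2) n) :=
        mul_le_mul_of_nonneg_left h1 (by norm_num)
      _ ≤ s * airyBeta lam (s ^ 2) (n + 1) * (s ^ n * airyNorm lam (s ^ 2) n) :=
        mul_le_mul_of_nonneg_right h2 hN
      _ = _ := by ring

/-- `β_{n+1}` is a quotient of consecutive norms: the numerator is bounded above by concentration,
the denominator below by the lower bounds on the earlier `β_j`. -/
lemma exists_airyBeta_le (n : ℕ) : ∃ K : ℝ, 0 ≤ K ∧
    ∀ᶠ s : ℝ in atTop, s * airyBeta lam (s ^ 2) n ≤ K := by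
  rcases n with _ | n
  · exact ⟨0, le_rfl, Eventually.of_forall fun s => by simp [airyBeta_zero]⟩
  obtain ⟨D, hD0, hD⟩ := exists_airyNorm_le hlam (n + 1)
  refine ⟨2 * D * 36 ^ n, by positivity, ?_⟩
  filter_upwards [eventually_airyNorm_ge hlam n, eventually_airyAlpha_le hlam 0,
    eventually_ge_atTop 1] with s h1 h2 h3
  have hs : 0 < s := by linarith
  have hN0 := airyNorm_pos hlam (s ^ 2) 0
  have hN := airyNorm_pos hlam (s ^ 2) n
  have g1 : s ^ (n + 1) * airyNorm lam (s ^ 2) (n + 1) ≤ 2 * D * airyNorm lam (s ^ 2) 0 := by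
    refine le_of_mul_le_mul_left ?_ hs
    have := mul_le_mul_of_nonneg_left (mul_le_mul_of_nonneg_right h2 hN0.le) hD0
    have := hD s h3
    rw [pow_succ] at this
    linarith
  have g2 : airyNorm lam (s ^ 2) 0 ≤ 36 ^ n * (s ^ n * airyNorm lam (s ^ 2) n) := by
    have := mul_le_mul_of_nonneg_left h1 (by positivity : (0 : ℝ) ≤ 36 ^ n)
    rwa [← mul_assoc, ← mul_pow, mul_one_div_cancel (by norm_num), one_pow, one_mul] at this
  refine le_of_mul_le_mul_right ?_ (mul_pos (pow_pos hs n) hN)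
  calc _ = s ^ (n + 1) * (airyBeta lam (s ^ 2) (n + 1) * airyNorm lam (s ^ 2) n) := by ring
    _ = s ^ (n + 1) * airyNorm lam (s ^ 2) (n + 1) := by rw [airyBeta_succ_mul hlam]
    _ ≤ 2 * D * airyNorm lam (s ^ 2) 0 := g1
    _ ≤ 2 * D * (36 ^ n * (s ^ n * airyNorm lam (s ^ 2) n)) :=
      mul_le_mul_of_nonneg_left g2 (by positivity)
    _ = _ := by ring

lemma airyAlpha_mul_sq_sub_le (s : ℝ) (n : ℕ) :
    airyAlpha lam (s ^ 2) n * (airyAlpha lam (s ^ 2) n ^ 2 - s ^ 2) ≤ 2 * n + 1 + lam := by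
  have e := cubeDiag_airy hlam (s ^ 2) n
  have ha := fun n => (airyAlpha_pos hlam (s ^ 2) n).le
  have hb := fun n => airyBeta_nonneg hlam (s ^ 2) n
  unfold cubeDiag at e
  have g1 := mul_nonneg (ha n) (add_nonneg (hb n) (hb (n + 1)))
  have g2 := mul_nonneg (ha (n - 1)) (hb n)
  have g3 := mul_nonneg (ha (n + 1)) (hb (n + 1))
  linarith

/-- With `α ≤ 2s` and `β = O(1/s)`, all `β` terms of the diagonal string equation are bounded. Thus
`α_n` is near `s` or near `0`. -/
lemma exists_le_airyAlpha_mul_sq_sub (n : ℕ) : ∃ K : ℝ, 0 ≤ K ∧ ∀ᶠ s : ℝ in atTop,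
    -K ≤ airyAlpha lam (s ^ 2) n * (airyAlpha lam (s ^ 2) n ^ 2 - s ^ 2) := by
  obtain ⟨K, hK, h⟩ := exists_airyBeta_le hlam n
  obtain ⟨K', hK', h'⟩ := exists_airyBeta_le hlam (n + 1)
  refine ⟨6 * K + 6 * K', by positivity, ?_⟩
  filter_upwards [h, h', eventually_airyAlpha_le hlam n, eventually_airyAlpha_le hlam (n - 1),
    eventually_airyAlpha_le hlam (n + 1)] with s h h' h1 h2 h3
  have e := cubeDiag_airy hlam (s ^ 2) n
  have hb := fun n => airyBeta_nonneg hlam (s ^ 2) n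
  have hn : (0 : ℝ) ≤ n := n.cast_nonneg
  unfold cubeDiag at e
  have g1 := mul_le_mul_of_nonneg_right h1 (hb n)
  have g2 := mul_le_mul_of_nonneg_right h1 (hb (n + 1))
  have g3 := mul_le_mul_of_nonneg_right h2 (hb n)
  have g4 := mul_le_mul_of_nonneg_right h3 (hb (n + 1))
  linarith

/-- Suppose `α_n` is on the branch near `s` and `α_{n+1} < s/2`. Then `α_{n+1} = O(s^(-2))`, so the
bracket in the off-diagonal string equation at `n + 1` has a bounded upper estimate instead of
growing like `s^2`. As `β_{n+1}` is bounded, the left side cannot reach the sum of the `α_j`, which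
is at least `s/2`. -/
lemma eventually_airyAlpha_ge (n : ℕ) :
    ∀ᶠ s : ℝ in atTop, s / 2 ≤ airyAlpha lam (s ^ 2) n := by
  induction n with
  | zero => exact eventually_airyAlpha_zero_ge hlam
  | succ n ih =>
    obtain ⟨K, hK, hk⟩ := exists_le_airyAlpha_mul_sq_sub hlam (n + 1)
    obtain ⟨K0, hK0, hk0⟩ := exists_airyBeta_le hlam n
    obtain ⟨K1, hK1, hk1⟩ := exists_airyBeta_le hlam (n + 1)
    obtain ⟨K2, hK2, hk2⟩ := exists_airyBeta_le hlam (n + 2)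
    set E := 5 * K + 2 * (2 * n + 1 + lam) + K0 + K1 + K2 with hE
    have hn : (0 : ℝ) ≤ n := n.cast_nonneg
    have hE0 : 0 ≤ E := by linarith
    filter_upwards [ih, hk, hk0, hk1, hk2, eventually_airyAlpha_le hlam n,
      eventually_airyAlpha_sum_ge hlam n, eventually_ge_atTop 1,
      eventually_gt_atTop (2 * (K1 * E))] with s h1 h2 b0 b1 b2 h3 h4 h5 h6
    by_contra! h
    have hs : 0 < s := by linarith
    have hup := airyAlpha_mul_sq_sub_le hlam s n
    have e := airyBeta_string hlam (s ^ 2) (n + 1)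
    rw [Nat.add_sub_cancel, show n + 1 + 1 = n + 2 from rfl] at e
    rw [← e] at h4
    have ha := airyAlpha_pos hlam (s ^ 2) n
    have ha' := airyAlpha_pos hlam (s ^ 2) (n + 1)
    have hb := fun n => airyBeta_nonneg hlam (s ^ 2) n
    have hbs : ∀ n, airyBeta lam (s ^ 2) n ≤ s * airyBeta lam (s ^ 2) n := fun n =>
      le_mul_of_one_le_left (hb n) h5
    set a := airyAlpha lam (s ^ 2) n
    set a' := airyAlpha lam (s ^ 2) (n + 1)
    have g1 : s ^ 2 * a' ≤ 2 * K := by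
      have : a' ^ 2 ≤ (s / 2) ^ 2 := pow_le_pow_left₀ ha'.le h.le 2
      have := mul_le_mul_of_nonneg_left this ha'.le
      have : 0 ≤ s ^ 2 * a' := by positivity
      linarith
    have g2 : a' ^ 2 + a' * a ≤ 5 * K := by
      have q1 : a' * (a' + a) ≤ a' * (5 / 2 * s) :=
        mul_le_mul_of_nonneg_left (by linarith) ha'.le
      have q2 : a' * s ≤ s ^ 2 * a' := by
        have := mul_le_mul_of_nonneg_left h5 (mul_pos ha' hs).le
        linarith
      linarith
    have g3 : a ^ 2 - s ^ 2 ≤ 2 * (2 * n + 1 + lam) := by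
      by_contra! hc
      have q0 : 0 < 2 * (n : ℝ) + 1 + lam := by linarith
      have q1 : (1 / 2) * (a ^ 2 - s ^ 2) ≤ a * (a ^ 2 - s ^ 2) :=
        mul_le_mul_of_nonneg_right (by linarith) (by linarith)
      linarith
    have g4 : airyBeta lam (s ^ 2) (n + 1) * (a' ^ 2 + a' * a + a ^ 2 +
        airyBeta lam (s ^ 2) (n + 2) + airyBeta lam (s ^ 2) (n + 1) + airyBeta lam (s ^ 2) n
        - s ^ 2) ≤ K1 * E := by
      refine (mul_le_mul_of_nonneg_left (c := E) ?_ (hb _)).trans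
        (mul_le_mul_of_nonneg_right ((hbs _).trans b1) hE0)
      linarith [hbs n, hbs (n + 1), hbs (n + 2)]
    linarith

/-- Since `α ≥ s/2`, the factor `α (α + s)` of `α (α^2 - s^2)` is at least `s^2/2`, so boundedness
of the product controls `s^2 |α - s|`. -/
lemma exists_abs_sq_mul_airyAlpha_sub_le (n : ℕ) : ∃ K : ℝ, ∀ᶠ s : ℝ in atTop,
    |s ^ 2 * (airyAlpha lam (s ^ 2) n - s)| ≤ K := by
  obtain ⟨K, hK, hk⟩ := exists_le_airyAlpha_mul_sq_sub hlam n
  refine ⟨2 * max K (2 * n + 1 + lam), ?_⟩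
  filter_upwards [hk, eventually_airyAlpha_ge hlam n, eventually_ge_atTop 1] with s h1 h2 h3
  have h4 := airyAlpha_mul_sq_sub_le hlam s n
  set a := airyAlpha lam (s ^ 2) n
  have h5 : |a * (a ^ 2 - s ^ 2)| ≤ max K (2 * n + 1 + lam) :=
    abs_le.2 ⟨by linarith [le_max_left K (2 * n + 1 + lam)], h4.trans (le_max_right _ _)⟩
  have hs : 0 < s := by linarith
  have e : |a * (a ^ 2 - s ^ 2)| = a * (a + s) * |a - s| := by
    rw [show a * (a ^ 2 - s ^ 2) = a * (a + s) * (a - s) by ring, abs_mul,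
      abs_of_pos (by have : 0 < a := by linarith
                     positivity)]
  have h6 : s ^ 2 ≤ 2 * (a * (a + s)) := by nlinarith
  rw [abs_mul, abs_of_pos (by positivity : 0 < s ^ 2)]
  calc _ ≤ 2 * (a * (a + s)) * |a - s| := mul_le_mul_of_nonneg_right h6 (abs_nonneg _)
    _ = 2 * |a * (a ^ 2 - s ^ 2)| := by rw [e]; ring
    _ ≤ _ := by linarith

/-! ### The expansion as `t → +∞`. -/

lemma airySubleading_sq_atTop (n : ℕ) :
    (fun s : ℝ => airySubleading lam n (s ^ 2) -
        (-(n : ℝ) * s + (n : ℝ) * (n - 2 * lam) / (4 * s ^ 2) +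
          (n : ℝ) * (4 * (n : ℝ) ^ 2 - 24 * n * lam + 12 * lam ^ 2 + 1) / (32 * s ^ 5)))
      =O[atTop] fun s : ℝ => 1 / (s ^ 2) ^ 4 := by
  have hpos : ∀ᶠ s : ℝ in atTop, 0 < s := eventually_gt_atTop 0
  set ε : ℝ → ℝ := fun s => 1 / s ^ 3 with hεd
  set A : ℕ → ℝ → ℝ := fun n s => s ^ 2 * (airyAlpha lam (s ^ 2) n - s) with hAd
  set B : ℕ → ℝ → ℝ := fun n s => s * airyBeta lam (s ^ 2) n with hBd
  have hA : ∀ n, A n =O[atTop] (1 : ℝ → ℝ) := fun n => by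
    obtain ⟨K, hK⟩ := exists_abs_sq_mul_airyAlpha_sub_le hlam n
    exact IsBigO.of_bound K (hK.mono fun s hs => by simpa [hAd] using hs)
  have hB : ∀ n, B n =O[atTop] (1 : ℝ → ℝ) := fun n => by
    obtain ⟨K, -, hK⟩ := exists_airyBeta_le hlam n
    refine IsBigO.of_bound K ?_
    filter_upwards [hK, hpos] with s h1 h2
    rw [Real.norm_of_nonneg (mul_nonneg h2.le (airyBeta_nonneg hlam _ _))]
    simpa [hBd] using h1
  have hε : ε =O[atTop] (1 : ℝ → ℝ) := by
    refine IsBigO.of_bound 1 ((eventually_ge_atTop 1).mono fun s hs => ?_)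
    have : 1 ≤ |s| ^ 3 := one_le_pow₀ (by rw [abs_of_nonneg (by linarith)]; exact hs)
    simpa [hεd] using inv_le_one_of_one_le₀ this
  have h1 : ∀ n, ∀ᶠ t in atTop, 2 * A n t + 3 * (B n t + B (n + 1) t) +
      ε t * (3 * A n t ^ 2 + ε t * A n t ^ 3 + 2 * A n t * (B n t + B (n + 1) t)
        + A (n - 1) t * B n t + A (n + 1) t * B (n + 1) t) = 2 * n + 1 + lam :=
    fun n => hpos.mono fun s hs => by
      have h := airyAlpha_string hlam (s ^ 2) n
      have hs' := hs.ne'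
      simp only [hAd, hBd, hεd]
      field_simp
      linear_combination h
  have h2 : ∀ n, ∀ᶠ t in atTop, 2 * B n t + ε t * (B n t * (3 * (A n t + A (n - 1) t)
        + ε t * (A n t ^ 2 + A n t * A (n - 1) t + A (n - 1) t ^ 2)
        + (B (n + 1) t + B n t + B (n - 1) t))) = n + ε t * ∑ j ∈ Finset.range n, A j t :=
    fun n => hpos.mono fun s hs => by
      have h := airyBeta_string hlam (s ^ 2) n
      have hs' := hs.ne'
      simp only [hAd, hBd, hεd, ← Finset.mul_sum, Finset.sum_sub_distrib, Finset.sum_const,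
        Finset.card_range, nsmul_eq_mul]
      field_simp
      linear_combination h
  -- Since `α_j = s + A_j / s^2`, the `O(ε^2)` error in the sum of the `A_j` is multiplied by
  -- `-1/s^2`, giving `s^(-8) = t^(-4)`.
  have h := (isBigO_refl (fun s : ℝ => -(1 / s ^ 2)) atTop).mul
    (hermite_expansion hε lam hA hB h1 h2 n)
  refine h.congr' (hpos.mono fun s hs => ?_) EventuallyEq.rfl |>.trans ?_
  · have hs' := hs.ne'
    simp only [airySubleading_eq_neg_sum hlam, hAd, ← Finset.mul_sum, Finset.sum_sub_distrib,
      Finset.sum_const, Finset.card_range, nsmul_eq_mul, hεd]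
    field_simp
    ring
  · refine IsBigO.of_bound 1 (hpos.mono fun s hs => ?_)
    rw [one_mul]
    refine le_of_eq ?_
    rw [← norm_neg]
    congr 1
    simp only [hεd]
    field_simp

lemma airySubleading_atTop (n : ℕ) :
    (fun t : ℝ => airySubleading lam n t -
        (-(n : ℝ) * √t + (n : ℝ) * (n - 2 * lam) / (4 * t) +
          (n : ℝ) * (4 * (n : ℝ) ^ 2 - 24 * n * lam + 12 * lam ^ 2 + 1) /
            (32 * t ^ (5 / 2 : ℝ))))
      =O[atTop] fun t : ℝ => 1 / t ^ 4 := by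
  have h := (airySubleading_sq_atTop hlam n).comp_tendsto Real.tendsto_sqrt_atTop
  have hpos : ∀ᶠ t : ℝ in atTop, 0 ≤ t := eventually_ge_atTop 0
  refine h.congr' (hpos.mono fun t ht => ?_) (hpos.mono fun t ht => ?_)
  · have e : t ^ (5 / 2 : ℝ) = √t ^ 5 := by
      rw [Real.sqrt_eq_rpow, ← Real.rpow_natCast, ← Real.rpow_mul ht]
      norm_num
    simp only [Function.comp, Real.sq_sqrt ht, e]
  · simp only [Function.comp, Real.sq_sqrt ht]

end

theorem theorem5p2 (lam : ℝ) (hlam : -1 < lam) (n : ℕ) :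
    ((fun t : ℝ => airySubleading lam n t -
        (-(n : ℝ) * √t + (n : ℝ) * (n - 2 * lam) / (4 * t) +
          (n : ℝ) * (4 * (n : ℝ) ^ 2 - 24 * n * lam + 12 * lam ^ 2 + 1) /
            (32 * t ^ (5 / 2 : ℝ))))
      =O[atTop] fun t : ℝ => 1 / t ^ 4) ∧
    ((fun t : ℝ => airySubleading lam n t -
        ((n : ℝ) * (n + lam) / t +
          (n : ℝ) * (n + lam) * (5 * (n : ℝ) ^ 2 + 5 * n * lam + lam ^ 2 + 1) / t ^ 4))
      =O[atBot] fun t : ℝ => 1 / t ^ 7) :=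
  ⟨airySubleading_atTop hlam n, airySubleading_atBot hlam n⟩
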